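/- Let $X$ be a compact ANR (a compact metrizable space that, whenever it is embedded as a closed subset of a metrizable space, is a retract of an open neighbourhood of its image), let $f:X\to\mathbb S^1$ be a continuous map, and let $p:\mathbb R\to\mathbb S^1$, $p(s)=e^{is}$. Let $\tilde f:\tilde X\to\mathbb R$ be an infinite cyclic cover of $f$: that is, $\tilde X$ is a topological space with a free continuous action $\mu:\mathbb Z\times\tilde X\to\tilde X$, and $\pi:\tilde X\to X$, $\tilde f:\tilde X\to\mathbb R$ are continuous maps such that $p\circ\tilde f=f\circ\pi$, $\pi(\mu(n,x))=\pi(x)$, $\pi$ induces a homeomorphism $\tilde X/\mathbb Z\to X$, and $\tilde f(\mu(n,x))=\tilde f(x)+2\pi n$ for all $n\in\mathbb Z$, $x\in\tilde X$ (in this last formula $\pi$ denotes the number). Let $\kappa$ be a field, let $r\ge 0$ be an integer, and let $H_r(\cdot)=H_r(\cdot\,;\kappa)$ denote singular homology. Regard $H_r(\tilde X)$ as a module over the ring $\kappa[t^{-1},t]$ of Laurent polynomials, where $t$ acts by the isomorphism $t_r$ induced by $\tau=\mu(1,\cdot):\tilde X\to\tilde X$, and let $T(H_r(\tilde X))$ be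 its $\kappa[t^{-1},t]$-torsion submodule. For $a,b\in\mathbb R$ put $$\mathbb I_a(r)=\mathrm{img}\big(H_r(\tilde f^{-1}((-\infty,a]))\to H_r(\tilde X)\big),\qquad \mathbb I^b(r)=\mathrm{img}\big(H_r(\tilde f^{-1}([b,\infty)))\to H_r(\tilde X)\big),$$ $$\mathbb F_r(a,b)=\mathbb I_a(r)\cap\mathbb I^b(r),\qquad \mathbb I_{-\infty}(r)=\bigcap_{a\in\mathbb R}\mathbb I_a(r),\qquad \mathbb I^{\infty}(r)=\bigcap_{b\in\mathbb R}\mathbb I^b(r).$$ Then: 1. for all $a,b\in\mathbb R$, the $\kappa$-vector space $\mathbb F_r(a,b)$ is finite-dimensional; 2. $\mathbb I_{-\infty}(r)=\mathbb I^{\infty}(r)=T(H_r(\tilde X))$. -/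

import Mathlib

open CategoryTheory AlgebraicTopology

open scoped LaurentPolynomial

universe k u v

/-- A compact absolute neighbourhood retract: a compact metrizable space which, whenever it is
embedded as a closed subset of a metrizable space `Y`, is a retract of an open neighbourhood of
its image in `Y`. -/
structure IsCompactANR (X : Type u) [TopologicalSpace X] : Prop where
  compact : CompactSpace X
  metrizable : TopologicalSpace.MetrizableSpace X
  exists_retraction : ∀ (Y : Type u) [TopologicalSpace Y] [TopologicalSpace.MetrizableSpace Y]
    (i : X → Y), Topology.IsClosedEmbedding i →
      ∃ U : Set Y, IsOpen U ∧ ∃ hU : ∀ x, i x ∈ U, ∃ ρ : C(U, X), ∀ x, ρ ⟨i x, hU x⟩ = x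

/-- `fLift : E → ℝ`, together with `π : E → X` and the action of `ℤ` on `E`, is an infinite cyclic
cover of the angle valued map `f : X → S¹`. The covering `ℝ → S¹` is `s ↦ exp (i s)`. -/
structure IsInfiniteCyclicCover {X : Type u} [TopologicalSpace X] {E : Type v}
    [TopologicalSpace E] [AddAction ℤ E] [ContinuousConstVAdd ℤ E]
    (f : C(X, Circle)) (π : C(E, X)) (fLift : C(E, ℝ)) : Prop where
  /-- The square formed by `fLift`, `f`, `π` and `ℝ → S¹` commutes. -/
  comm : ∀ x, Circle.exp (fLift x) = f (π x)
  /-- The action of `ℤ` is free. -/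
  free : ∀ (n : ℤ) (x : E), n +ᵥ x = x → n = 0
  /-- The map `π` is invariant and induces a homeomorphism `E / ℤ ≃ X`. -/
  homeo : ∃ e : AddAction.orbitRel.Quotient ℤ E ≃ₜ X,
    ∀ x : E, e (Quotient.mk (AddAction.orbitRel ℤ E) x) = π x
  /-- The map `fLift` is equivariant. -/
  equivariant : ∀ (n : ℤ) (x : E), fLift (n +ᵥ x) = fLift x + 2 * Real.pi * n

noncomputable section

/-- Singular homology `H_r(Y; κ)`, a `κ`-vector space. -/
abbrev SingHom (κ : Type k) [Field κ] (r : ℕ) (Y : Type v) [TopologicalSpace Y] :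
    Type (max k v) :=
  (((singularHomologyFunctor.{v} (ModuleCat.{max k v} κ) r).obj
    (ModuleCat.of κ (ULift.{v} κ))).obj (TopCat.of Y) : ModuleCat.{max k v} κ)

/-- The linear map `H_r(Y; κ) → H_r(Z; κ)` induced by a continuous map. -/
def SingHom.map (κ : Type k) [Field κ] (r : ℕ) {Y Z : Type v} [TopologicalSpace Y]
    [TopologicalSpace Z] (g : C(Y, Z)) : SingHom κ r Y →ₗ[κ] SingHom κ r Z :=
  (((singularHomologyFunctor.{v} (ModuleCat.{max k v} κ) r).obj
    (ModuleCat.of κ (ULift.{v} κ))).map (TopCat.ofHom g)).hom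

lemma SingHom.map_id (κ : Type k) [Field κ] (r : ℕ) {Y : Type v} [TopologicalSpace Y] :
    SingHom.map κ r (ContinuousMap.id Y) = LinearMap.id := by
  have h : TopCat.ofHom (ContinuousMap.id Y) = 𝟙 (TopCat.of Y) := rfl
  rw [SingHom.map, h, CategoryTheory.Functor.map_id]
  rfl

lemma SingHom.map_comp (κ : Type k) [Field κ] (r : ℕ) {Y Z W : Type v} [TopologicalSpace Y]
    [TopologicalSpace Z] [TopologicalSpace W] (g : C(Y, Z)) (h : C(Z, W)) :
    SingHom.map κ r (h.comp g) = SingHom.map κ r h ∘ₗ SingHom.map κ r g := by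
  have e : TopCat.ofHom (h.comp g) = TopCat.ofHom g ≫ TopCat.ofHom h := rfl
  rw [SingHom.map, e, CategoryTheory.Functor.map_comp]
  rfl

section Module

variable (κ : Type k) [Field κ] (r : ℕ) (E : Type v) [TopologicalSpace E] [AddAction ℤ E]
  [ContinuousConstVAdd ℤ E]

/-- The action of the integer `n` on `E`, as a continuous map. -/
def deckMap (n : ℤ) : C(E, E) := ⟨fun x => n +ᵥ x, continuous_const_vadd n⟩

/-- The representation of `ℤ` on `H_r(E; κ)` by the maps induced by the action of `ℤ` on `E`;
the generator `1` acts as `t_r`, the map induced by the deck transformation `x ↦ 1 +ᵥ x`. -/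
def deckRep : Multiplicative ℤ →* Module.End κ (SingHom κ r E) where
  toFun n := SingHom.map κ r (deckMap E n.toAdd)
  map_one' := by
    have h : deckMap E (1 : Multiplicative ℤ).toAdd = ContinuousMap.id E := by
      ext x; simp [deckMap]
    rw [h, SingHom.map_id]; rfl
  map_mul' m n := by
    have h : deckMap E (m * n).toAdd = (deckMap E m.toAdd).comp (deckMap E n.toAdd) := by
      ext x; simp [deckMap, add_vadd]
    rw [h, SingHom.map_comp]; rfl

/-- The structure of `κ[t⁻¹, t]`-module on `H_r(E; κ)` in which `t` acts as `t_r`. -/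
instance laurentModule : Module κ[T;T⁻¹] (SingHom κ r E) :=
  Module.compHom (SingHom κ r E)
    (AddMonoidAlgebra.lift κ (Module.End κ (SingHom κ r E)) ℤ (deckRep κ r E)).toRingHom

lemma laurent_smul_def (p : κ[T;T⁻¹]) (x : SingHom κ r E) :
    p • x = AddMonoidAlgebra.lift κ (Module.End κ (SingHom κ r E)) ℤ (deckRep κ r E) p x := rfl

instance laurentTower : IsScalarTower κ κ[T;T⁻¹] (SingHom κ r E) where
  smul_assoc c p x := by
    simp [laurent_smul_def]

/-- The `κ[t⁻¹, t]`-torsion `T(H_r(E; κ))`, regarded as a `κ`-subspace of `H_r(E; κ)`. -/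
def torsionSub : Submodule κ (SingHom κ r E) :=
  (Submodule.torsion κ[T;T⁻¹] (SingHom κ r E)).restrictScalars κ

end Module

section Levels

variable (κ : Type k) [Field κ] (r : ℕ) {E : Type v} [TopologicalSpace E]

/-- The image of `H_r(A; κ) → H_r(E; κ)` for a subspace `A` of `E`. -/
def imageOfSubspace (A : Set E) : Submodule κ (SingHom κ r E) :=
  LinearMap.range (SingHom.map κ r (⟨Subtype.val, continuous_subtype_val⟩ : C(A, E)))

/-- `𝕀_a(r)`, the image of the homology of the closed sublevel `g ≤ a`. -/
def subImage (g : C(E, ℝ)) (a : ℝ) : Submodule κ (SingHom κ r E) :=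
  imageOfSubspace κ r (g ⁻¹' Set.Iic a)

/-- `𝕀^b(r)`, the image of the homology of the closed overlevel `b ≤ g`. -/
def overImage (g : C(E, ℝ)) (b : ℝ) : Submodule κ (SingHom κ r E) :=
  imageOfSubspace κ r (g ⁻¹' Set.Ici b)

/-- `𝕀_{-∞}(r)`. -/
def subImageInf (g : C(E, ℝ)) : Submodule κ (SingHom κ r E) := ⨅ a : ℝ, subImage κ r g a

/-- `𝕀^∞(r)`. -/
def overImageInf (g : C(E, ℝ)) : Submodule κ (SingHom κ r E) := ⨅ b : ℝ, overImage κ r g b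

/-- `𝔽_r(a, b) = 𝕀_a(r) ∩ 𝕀^b(r)`. -/
def levelInter (g : C(E, ℝ)) (a b : ℝ) : Submodule κ (SingHom κ r E) :=
  subImage κ r g a ⊓ overImage κ r g b

end Levels

end

/-! A class in `𝕀_a ∩ 𝕀^b` comes, by Mayer-Vietoris, from a slab `fLift ⁻¹' [c, a]` with `c ≤ b` and
`c < a` (`levelInter_le_imageOfSubspace`). The cover is the pullback of `ℝ → S¹` along `f`, a closed
subset of `X × ℝ`, so the slab is compact. Since `X` is a retract of an open subset of `ℓ^∞`, the
cover is a retract of an open subset `N` of `ℓ^∞ × ℝ`, and the inclusion of the slab into the cover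
factors through `N`. The compact image of the slab in `N` is covered by finitely many balls whose
intersections are convex; subdivision and Mayer-Vietoris make the image in homology
finite-dimensional (`finiteDimensional_range_map`). This gives the first claim.

For torsion, the leading term of a relation `∑ cₙ tⁿ x = 0` expresses a translate of `x` by lower
ones, so `x ∈ 𝕀_a` implies `x ∈ 𝕀_{a-2π}`, and iteration gives `x ∈ 𝕀_{-∞}` (`mem_of_sum_eq_zero`).
Conversely, a class in `𝕀_{-∞}` has compact support, hence lies in some `𝕀^{-C}`; all `tⁿ x` with `n
≥ 0` then lie in the finite-dimensional space `𝕀_0 ∩ 𝕀^{-C}`, and a linear dependence among them is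
a Laurent polynomial killing `x`. The case of `𝕀^∞` is symmetric. -/

noncomputable section

/-! ### Homology classes of explicit cycles -/

section HomologyClass

variable {κ : Type k} [Field κ] (K : ChainComplex (ModuleCat.{v} κ) ℕ) (n : ℕ)

/-- The homology class of a cycle of a chain complex of vector spaces. -/
def ChainComplex.homologyClass :
    LinearMap.ker (K.d n ((ComplexShape.down ℕ).next n)).hom →ₗ[κ] K.homology n :=
  (K.liftCycles (ModuleCat.ofHom (LinearMap.ker (K.d n ((ComplexShape.down ℕ).next n)).hom).subtype)
    _ rfl (by ext x; exact x.2) ≫ K.homologyπ n).hom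

variable {K n}

lemma ChainComplex.homologyClass_iCycles (c : K.cycles n)
    (hc : K.iCycles n c ∈ LinearMap.ker (K.d n ((ComplexShape.down ℕ).next n)).hom) :
    homologyClass K n ⟨K.iCycles n c, hc⟩ = K.homologyπ n c := by
  have hmono : Function.Injective (K.iCycles n) :=
    (ModuleCat.mono_iff_injective _).1 inferInstance
  have : K.liftCycles (ModuleCat.ofHom
      (LinearMap.ker (K.d n ((ComplexShape.down ℕ).next n)).hom).subtype)
      _ rfl (by ext x; exact x.2) ⟨K.iCycles n c, hc⟩ = c := by
    apply hmono
    rw [← ConcreteCategory.comp_apply, HomologicalComplex.liftCycles_i]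
    rfl
  simp only [homologyClass, ModuleCat.hom_comp, LinearMap.comp_apply]
  exact congrArg _ this

lemma ChainComplex.iCycles_mem (c : K.cycles n) :
    K.iCycles n c ∈ LinearMap.ker (K.d n ((ComplexShape.down ℕ).next n)).hom := by
  rw [LinearMap.mem_ker]
  change (K.d n _) (K.iCycles n c) = 0
  rw [← ConcreteCategory.comp_apply, HomologicalComplex.iCycles_d]
  rfl

lemma ChainComplex.exists_iCycles
    (z : LinearMap.ker (K.d n ((ComplexShape.down ℕ).next n)).hom) :
    ∃ c : K.cycles n, K.iCycles n c = z := by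
  refine ⟨K.liftCycles (ModuleCat.ofHom
      (LinearMap.ker (K.d n ((ComplexShape.down ℕ).next n)).hom).subtype)
      _ rfl (by ext x; exact x.2) z, ?_⟩
  rw [← ConcreteCategory.comp_apply, HomologicalComplex.liftCycles_i]
  rfl

lemma ChainComplex.homologyClass_surjective : Function.Surjective (homologyClass K n) := by
  intro h
  obtain ⟨c, rfl⟩ := (ModuleCat.epi_iff_surjective (K.homologyπ n)).1 inferInstance h
  exact ⟨_, homologyClass_iCycles c (iCycles_mem c)⟩

/-- Homology is the cokernel of `K.toCycles`, and cokernels in modules are exact at the middle term.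
-/
lemma ChainComplex.homologyClass_eq_zero_iff
    (z : LinearMap.ker (K.d n ((ComplexShape.down ℕ).next n)).hom) :
    homologyClass K n z = 0 ↔ ∃ w : K.X (n + 1), K.d (n + 1) n w = z := by
  obtain ⟨c, hc⟩ := exists_iCycles z
  have hz : z = ⟨K.iCycles n c, iCycles_mem c⟩ := Subtype.ext hc.symm
  have hmono : Function.Injective (K.iCycles n) :=
    (ModuleCat.mono_iff_injective _).1 inferInstance
  have hex := ShortComplex.exact_of_g_is_cokernel
    (ShortComplex.mk (K.toCycles (n + 1) n) (K.homologyπ n) (K.toCycles_comp_homologyπ _ _))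
    (K.homologyIsCokernel (n + 1) n (by simp))
  rw [ShortComplex.moduleCat_exact_iff] at hex
  rw [hz, homologyClass_iCycles]
  constructor
  · intro h
    obtain ⟨w, hw⟩ := hex c h
    refine ⟨w, ?_⟩
    rw [← hw]
    change _ = K.iCycles n (K.toCycles (n + 1) n w)
    rw [← ConcreteCategory.comp_apply, HomologicalComplex.toCycles_i]
  · rintro ⟨w, hw⟩
    have : c = K.toCycles (n + 1) n w := by
      apply hmono
      rw [← ConcreteCategory.comp_apply, HomologicalComplex.toCycles_i]
      exact hw.symm
    rw [this, ← ConcreteCategory.comp_apply, HomologicalComplex.toCycles_comp_homologyπ]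
    rfl

lemma ChainComplex.homologyMap_homologyClass {L : ChainComplex (ModuleCat.{v} κ) ℕ} (φ : K ⟶ L)
    (z : LinearMap.ker (K.d n ((ComplexShape.down ℕ).next n)).hom)
    (hz : φ.f n z ∈ LinearMap.ker (L.d n ((ComplexShape.down ℕ).next n)).hom) :
    HomologicalComplex.homologyMap φ n (homologyClass K n z) =
      homologyClass L n ⟨φ.f n z, hz⟩ := by
  obtain ⟨c, hc⟩ := exists_iCycles z
  have hz' : z = ⟨K.iCycles n c, iCycles_mem c⟩ := Subtype.ext hc.symm
  have h2 : φ.f n z = L.iCycles n (HomologicalComplex.cyclesMap φ n c) := by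
    rw [← ConcreteCategory.comp_apply, HomologicalComplex.cyclesMap_i, hz']
    rfl
  have h3 : (⟨φ.f n z, hz⟩ : LinearMap.ker (L.d n ((ComplexShape.down ℕ).next n)).hom) =
    ⟨_, iCycles_mem (HomologicalComplex.cyclesMap φ n c)⟩ := Subtype.ext h2
  rw [h3, homologyClass_iCycles, hz', homologyClass_iCycles, ← ConcreteCategory.comp_apply,
    ← ConcreteCategory.comp_apply, HomologicalComplex.homologyπ_naturality]

end HomologyClass

/-! ### Singular chains as finitely supported functions, and their comparison with the categorical
complex -/

/-- The inclusion of the `i`-th face of the standard simplex of dimension `n + 1`. -/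
def stdFace (n : ℕ) (i : Fin (n + 2)) :
    C(stdSimplex ℝ (Fin (n + 1)), stdSimplex ℝ (Fin (n + 1 + 1))) :=
  ⟨stdSimplex.map i.succAbove, stdSimplex.continuous_map _⟩

/-- Singular `n`-chains. -/
abbrev SingChain (κ : Type k) [Field κ] (n : ℕ) (Y : Type v) [TopologicalSpace Y] :=
  C(stdSimplex ℝ (Fin (n + 1)), Y) →₀ κ

namespace SingChain

variable {κ : Type k} [Field κ]

section Basic

variable {Y : Type v} [TopologicalSpace Y] {Z : Type u} [TopologicalSpace Z]

/-- The boundary of a singular chain. -/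
def boundary (n : ℕ) (Y : Type v) [TopologicalSpace Y] :
    SingChain κ (n + 1) Y →ₗ[κ] SingChain κ n Y :=
  Finsupp.linearCombination κ fun σ =>
    ∑ i : Fin (n + 2), (-1 : κ) ^ (i : ℕ) • Finsupp.single (σ.comp (stdFace n i)) 1

@[simp] lemma boundary_single (n : ℕ) (σ : C(stdSimplex ℝ (Fin (n + 1 + 1)), Y)) (c : κ) :
    boundary n Y (Finsupp.single σ c) =
      c • ∑ i : Fin (n + 2), (-1 : κ) ^ (i : ℕ) • Finsupp.single (σ.comp (stdFace n i)) 1 := by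
  simp [boundary]

/-- The chain map induced by a continuous map. -/
def map (n : ℕ) (g : C(Y, Z)) : SingChain κ n Y →ₗ[κ] SingChain κ n Z :=
  Finsupp.lmapDomain κ κ (fun σ => g.comp σ)

@[simp] lemma map_single (n : ℕ) (g : C(Y, Z)) (σ : C(stdSimplex ℝ (Fin (n + 1)), Y)) (c : κ) :
    map n g (Finsupp.single σ c) = Finsupp.single (g.comp σ) c := by
  simp [map]

lemma map_comp {W : Type*} [TopologicalSpace W] (n : ℕ) (h : C(Z, W)) (g : C(Y, Z))
    (c : SingChain κ n Y) : map n (h.comp g) c = map n h (map n g c) := by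
  induction c using Finsupp.induction_linear with
  | zero => simp
  | add a b ha hb => simp [ha, hb]
  | single σ c => simp [ContinuousMap.comp_assoc]

lemma map_boundary (n : ℕ) (g : C(Y, Z)) (c : SingChain κ (n + 1) Y) :
    map n g (boundary n Y c) = boundary n Z (map (n + 1) g c) := by
  induction c using Finsupp.induction_linear with
  | zero => simp
  | add a b ha hb => simp [ha, hb]
  | single σ c => simp [ContinuousMap.comp_assoc]

/-- The cycles. -/
def cycles (κ : Type k) [Field κ] : (n : ℕ) → (Y : Type v) → [TopologicalSpace Y] →
    Submodule κ (SingChain κ n Y)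
  | 0, _, _ => ⊤
  | n + 1, Y, _ => LinearMap.ker (boundary n Y)

lemma map_mem_cycles {n : ℕ} (g : C(Y, Z)) {c : SingChain κ n Y} (hc : c ∈ cycles κ n Y) :
    map n g c ∈ cycles κ n Z := by
  cases n with
  | zero => trivial
  | succ n =>
    have h : boundary n Y c = 0 := hc
    change boundary n Z (map (n + 1) g c) = 0
    rw [← map_boundary, h, _root_.map_zero]

end Basic

section Comparison

variable (κ) (n : ℕ) (Y : Type v) [TopologicalSpace Y]

/-- The singular chain complex of Mathlib. -/
abbrev complex : ChainComplex (ModuleCat.{max k v} κ) ℕ :=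
  (TopCat.toSSet.obj (TopCat.of Y)).chainComplex (ModuleCat.of κ (ULift.{v} κ))

/-- The basis element of the singular chain complex given by a singular simplex. -/
def basisElement (σ : C(stdSimplex ℝ (Fin (n + 1)), Y)) : (complex κ Y).X n :=
  ((TopCat.toSSet.obj (TopCat.of Y)).ιChainComplex
    (R := ModuleCat.of κ (ULift.{v} κ)) (n := n)
    (((TopCat.of Y).toSSetObjEquiv (.op (.mk n))).symm σ)).hom (ULift.up 1)

/-- The comparison map to the singular chain complex. -/
def toComplex : SingChain κ n Y →ₗ[κ] (complex κ Y).X n :=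
  Finsupp.linearCombination κ (basisElement κ n Y)

/-- The inverse of the comparison map. -/
def ofComplex : (complex κ Y).X n ⟶ ModuleCat.of κ (SingChain κ n Y) :=
  Limits.Cofan.IsColimit.desc ((TopCat.toSSet.obj (TopCat.of Y)).isColimitChainComplexXCofan
    (ModuleCat.of κ (ULift.{v} κ)) n)
    (fun x => ModuleCat.ofHom ((Finsupp.lsingle
      ((TopCat.of Y).toSSetObjEquiv (.op (.mk n)) x)).comp ULift.moduleEquiv.toLinearMap))

lemma ι_ofComplex (x : (TopCat.toSSet.obj (TopCat.of Y)).obj (.op (.mk n))) (a : ULift.{v} κ) :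
    ofComplex κ n Y (((TopCat.toSSet.obj (TopCat.of Y)).ιChainComplex
      (R := ModuleCat.of κ (ULift.{v} κ)) (n := n) x).hom a) =
      Finsupp.single ((TopCat.of Y).toSSetObjEquiv (.op (.mk n)) x) a.down := by
  have h := Limits.Cofan.IsColimit.fac
    ((TopCat.toSSet.obj (TopCat.of Y)).isColimitChainComplexXCofan
    (ModuleCat.of κ (ULift.{v} κ)) n)
    (fun x => ModuleCat.ofHom ((Finsupp.lsingle
      ((TopCat.of Y).toSSetObjEquiv (.op (.mk n)) x)).comp ULift.moduleEquiv.toLinearMap)) x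
  exact congrArg (fun f => f.hom a) h

lemma ofComplex_toComplex (c : SingChain κ n Y) :
    ofComplex κ n Y (toComplex κ n Y c) = c := by
  induction c using Finsupp.induction_linear with
  | zero => simp
  | add a b ha hb => rw [map_add, map_add, ha, hb]
  | single σ c =>
    rw [toComplex, Finsupp.linearCombination_single, map_smul, basisElement, ι_ofComplex]
    simp

/-- The chain object is a coproduct indexed by simplices, so the identity can be checked on each
summand. -/
lemma toComplex_ofComplex (x : (complex κ Y).X n) :
    toComplex κ n Y (ofComplex κ n Y x) = x := by
  have h : ofComplex κ n Y ≫ ModuleCat.ofHom (toComplex κ n Y) = 𝟙 _ := by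
    apply SSet.chainComplex_hom_ext
    intro x
    ext a
    refine (congrArg (toComplex κ n Y) (ι_ofComplex κ n Y x a)).trans ?_
    rw [toComplex, Finsupp.linearCombination_single, basisElement,
      Equiv.symm_apply_apply, ← map_smul]
    congr 1
    ext
    simp
  exact congrArg (fun f => f.hom x) h

lemma toSSetObjEquiv_δ (x : (TopCat.toSSet.obj (TopCat.of Y)).obj (.op (.mk (n + 1))))
    (i : Fin (n + 2)) :
    (TopCat.of Y).toSSetObjEquiv (.op (.mk n)) ((TopCat.toSSet.obj (TopCat.of Y)).δ i x) =
      ((TopCat.of Y).toSSetObjEquiv (.op (.mk (n + 1))) x).comp (stdFace n i) := by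
  rfl

lemma toComplex_boundary (c : SingChain κ (n + 1) Y) :
    toComplex κ n Y (boundary n Y c) =
      (complex κ Y).d (n + 1) n (toComplex κ (n + 1) Y c) := by
  induction c using Finsupp.induction_linear with
  | zero => simp
  | add a b ha hb => simp only [map_add, ha, hb]
  | single σ c =>
    rw [boundary_single, toComplex, toComplex, Finsupp.linearCombination_single, map_smul,
      map_smul, map_sum]
    congr 1
    obtain ⟨x, rfl⟩ := ((TopCat.of Y).toSSetObjEquiv (.op (.mk (n + 1)))).surjective σ
    have h := congrArg (fun f => f.hom (ULift.up (1 : κ)))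
      ((TopCat.toSSet.obj (TopCat.of Y)).ιChainComplex_d (ModuleCat.of κ (ULift.{v} κ)) x)
    simp only [basisElement, Equiv.symm_apply_apply]
    refine Eq.trans ?_ h.symm
    simp only [map_smul, Finsupp.linearCombination_single, basisElement, ModuleCat.hom_sum,
      LinearMap.sum_apply]
    refine Finset.sum_congr rfl fun i _ => ?_
    rw [← toSSetObjEquiv_δ, Equiv.symm_apply_apply, one_smul]
    rcases Nat.even_or_odd (i : ℕ) with hi | hi <;> simp [hi.neg_one_pow]

variable {Y} in
lemma toComplex_map {Z : Type v} [TopologicalSpace Z] (g : C(Y, Z)) (c : SingChain κ n Y) :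
    toComplex κ n Z (map n g c) =
      (SSet.chainComplexMap (TopCat.toSSet.map (TopCat.ofHom g)) (ModuleCat.of κ (ULift.{v} κ))).f n
        (toComplex κ n Y c) := by
  induction c using Finsupp.induction_linear with
  | zero => simp
  | add a b ha hb => simp only [map_add, ha, hb]
  | single σ c =>
    rw [map_single, toComplex, toComplex, Finsupp.linearCombination_single,
      Finsupp.linearCombination_single, map_smul]
    congr 1
    obtain ⟨x, rfl⟩ := ((TopCat.of Y).toSSetObjEquiv (.op (.mk n))).surjective σ
    have h := congrArg (fun f => f.hom (ULift.up (1 : κ)))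
      (SSet.ι_chainComplexMap_f _ _ (TopCat.toSSet.map (TopCat.ofHom g))
        (ModuleCat.of κ (ULift.{v} κ)) x)
    simp only [basisElement, Equiv.symm_apply_apply]
    refine Eq.trans ?_ h.symm
    have : g.comp (((TopCat.of Y).toSSetObjEquiv (.op (.mk n))) x) =
      ((TopCat.of Z).toSSetObjEquiv (.op (.mk n)))
        ((TopCat.toSSet.map (TopCat.ofHom g)).app _ x) := rfl
    rw [this, Equiv.symm_apply_apply]

variable {κ Y n}

/-- Transported from `d ∘ d = 0` in the categorical complex, which avoids the simplicial identities.
-/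
lemma boundary_boundary (c : SingChain κ (n + 2) Y) :
    boundary n Y (boundary (n + 1) Y c) = 0 := by
  rw [← ofComplex_toComplex κ n Y (boundary n Y (boundary (n + 1) Y c)), toComplex_boundary,
    toComplex_boundary]
  have h := congrArg (fun f => f.hom (toComplex κ (n + 1 + 1) Y c))
    ((complex κ Y).d_comp_d (n + 2) (n + 1) n)
  exact (congrArg (ofComplex κ n Y).hom h).trans (map_zero _)

lemma boundary_mem_cycles (c : SingChain κ (n + 1) Y) : boundary n Y c ∈ cycles κ n Y := by
  cases n with
  | zero => trivial
  | succ n => exact boundary_boundary c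

lemma toComplex_mem_ker_iff (c : SingChain κ n Y) :
    toComplex κ n Y c ∈ LinearMap.ker ((complex κ Y).d n ((ComplexShape.down ℕ).next n)).hom ↔
      c ∈ cycles κ n Y := by
  cases n with
  | zero =>
    refine ⟨fun _ => trivial, fun _ => ?_⟩
    rw [LinearMap.mem_ker, HomologicalComplex.shape _ _ _ (by simp)]
    rfl
  | succ n =>
    rw [LinearMap.mem_ker, ChainComplex.next_nat_succ]
    change (complex κ Y).d (n + 1) n (toComplex κ (n + 1) Y c) = 0 ↔ boundary n Y c = 0
    rw [← toComplex_boundary]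
    constructor
    · intro h
      rw [← ofComplex_toComplex κ n Y (boundary n Y c), h]
      exact map_zero (ofComplex κ n Y).hom
    · intro h
      rw [h, map_zero]

variable (κ Y n) in
/-- The homology class of a singular cycle. -/
def homologyClass : cycles κ n Y →ₗ[κ] SingHom κ n Y :=
  (ChainComplex.homologyClass (complex κ Y) n).comp
    ((toComplex κ n Y).restrict fun c hc => (toComplex_mem_ker_iff c).2 hc)

lemma homologyClass_surjective : Function.Surjective (homologyClass κ n Y) := by
  intro h
  obtain ⟨⟨z, hz⟩, rfl⟩ := ChainComplex.homologyClass_surjective (K := complex κ Y) h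
  have hz' : ofComplex κ n Y z ∈ cycles κ n Y := by
    rw [← toComplex_mem_ker_iff, toComplex_ofComplex]
    exact hz
  refine ⟨⟨_, hz'⟩, ?_⟩
  exact congrArg (ChainComplex.homologyClass (complex κ Y) n)
    (Subtype.ext (toComplex_ofComplex κ n Y z))

lemma homologyClass_eq_zero_iff (z : cycles κ n Y) :
    homologyClass κ n Y z = 0 ↔ ∃ w, boundary n Y w = z.1 := by
  refine (ChainComplex.homologyClass_eq_zero_iff _).trans ?_
  constructor
  · rintro ⟨w, hw⟩
    refine ⟨ofComplex κ (n + 1) Y w, ?_⟩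
    rw [← ofComplex_toComplex κ n Y (boundary n Y _), toComplex_boundary, toComplex_ofComplex, hw]
    exact ofComplex_toComplex κ n Y z
  · rintro ⟨w, hw⟩
    refine ⟨toComplex κ (n + 1) Y w, ?_⟩
    rw [← toComplex_boundary, hw]
    rfl

lemma homologyClass_eq_of_boundary {z z' : cycles κ n Y} {w : SingChain κ (n + 1) Y}
    (hw : boundary n Y w = z.1 - z'.1) : homologyClass κ n Y z = homologyClass κ n Y z' := by
  have h : z = z' + ⟨boundary n Y w, boundary_mem_cycles w⟩ := by
    apply Subtype.ext
    change z.1 = z'.1 + boundary n Y w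
    rw [hw, add_sub_cancel]
  rw [h, map_add, (homologyClass_eq_zero_iff ⟨boundary n Y w, _⟩).2 ⟨w, rfl⟩, add_zero]

lemma exists_boundary_of_homologyClass_eq {z z' : cycles κ n Y}
    (h : homologyClass κ n Y z = homologyClass κ n Y z') : ∃ w, boundary n Y w = z.1 - z'.1 := by
  have h' : z = z' + ⟨z.1 - z'.1, Submodule.sub_mem _ z.2 z'.2⟩ := by
    apply Subtype.ext
    change z.1 = z'.1 + (z.1 - z'.1)
    rw [add_sub_cancel]
  rw [h', map_add, add_eq_left] at h
  exact (homologyClass_eq_zero_iff _).1 h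

lemma map_homologyClass {Z : Type v} [TopologicalSpace Z] (g : C(Y, Z)) (z : cycles κ n Y) :
    SingHom.map κ n g (homologyClass κ n Y z) =
      homologyClass κ n Z ⟨map n g z, map_mem_cycles g z.2⟩ := by
  have h := ChainComplex.homologyMap_homologyClass
    (SSet.chainComplexMap (TopCat.toSSet.map (TopCat.ofHom g)) (ModuleCat.of κ (ULift.{v} κ)))
    ⟨_, (toComplex_mem_ker_iff z.1).2 z.2⟩ (by
      rw [← toComplex_map]
      exact (toComplex_mem_ker_iff _).2 (map_mem_cycles g z.2))
  refine h.trans ?_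
  exact congrArg (ChainComplex.homologyClass (complex κ Z) n)
    (Subtype.ext (toComplex_map κ n g z.1).symm)

end Comparison
end SingChain

/-! ### Cones over singular simplices in a contractible space -/

lemma stdFace_apply_succAbove (n : ℕ) (i : Fin (n + 2)) (s : stdSimplex ℝ (Fin (n + 1)))
    (j : Fin (n + 1)) : stdFace n i s (i.succAbove j) = s j := by
  change FunOnFinite.linearMap ℝ ℝ i.succAbove s (i.succAbove j) = s j
  rw [FunOnFinite.linearMap_apply_apply, Finset.sum_eq_single j]
  · intro b hb hne
    exact absurd (Fin.succAbove_right_injective (Finset.mem_filter.1 hb).2) hne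
  · intro h
    simp at h

lemma stdFace_apply_self (n : ℕ) (i : Fin (n + 2)) (s : stdSimplex ℝ (Fin (n + 1))) :
    stdFace n i s i = 0 := by
  change FunOnFinite.linearMap ℝ ℝ i.succAbove s i = 0
  rw [FunOnFinite.linearMap_apply_apply]
  refine Finset.sum_eq_zero fun b hb => ?_
  exact absurd (Finset.mem_filter.1 hb).2 (Fin.succAbove_ne i b)

/-- The join of the vertex `0` with the opposite face of the standard simplex. -/
def stdJoin (n : ℕ) :
    C(unitInterval × stdSimplex ℝ (Fin (n + 1)), stdSimplex ℝ (Fin (n + 1 + 1))) where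
  toFun p := ⟨Fin.cons (p.1 : ℝ) (fun j => (1 - (p.1 : ℝ)) * p.2 j), by
    constructor
    · intro j
      refine Fin.cases ?_ (fun j => ?_) j
      · exact p.1.2.1
      · exact mul_nonneg (sub_nonneg.2 p.1.2.2) (p.2.2.1 j)
    · rw [Fin.sum_univ_succ]
      simp [← Finset.mul_sum]⟩
  continuous_toFun := by
    refine Continuous.subtype_mk (continuous_pi fun j => ?_) _
    refine Fin.cases ?_ (fun j => ?_) j
    · exact continuous_subtype_val.comp continuous_fst
    · simp only [Fin.cons_succ]
      refine (continuous_const.sub (continuous_subtype_val.comp continuous_fst)).mul ?_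
      exact (continuous_apply j).comp (continuous_subtype_val.comp continuous_snd)

@[simp] lemma stdJoin_zero (n : ℕ) (p : unitInterval × stdSimplex ℝ (Fin (n + 1))) :
    stdJoin n p 0 = p.1 := rfl

@[simp] lemma stdJoin_succ (n : ℕ) (p : unitInterval × stdSimplex ℝ (Fin (n + 1)))
    (j : Fin (n + 1)) :
    stdJoin n p j.succ = (1 - p.1) * p.2 j := rfl

lemma stdJoin_surjective (n : ℕ) : Function.Surjective (stdJoin n) := by
  intro x
  have h1 : x 0 + ∑ j : Fin (n + 1), x j.succ = 1 := by
    rw [← Fin.sum_univ_succ (fun j => x j)]; exact x.2.2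
  let t : unitInterval := ⟨x 0, x.2.1 0, stdSimplex.le_one x 0⟩
  by_cases hx : x 0 = 1
  · refine ⟨(t, stdSimplex.vertex 0), ?_⟩
    ext j
    refine Fin.cases rfl (fun j => ?_) j
    rw [stdJoin_succ]
    have hs : ∑ j : Fin (n + 1), x j.succ = 0 := by linarith
    rw [Finset.sum_eq_zero_iff_of_nonneg (fun j _ => x.2.1 j.succ)] at hs
    rw [hs j (Finset.mem_univ _)]
    simp [t, hx]
  · have h0 : 1 - x 0 ≠ 0 := sub_ne_zero.2 (Ne.symm hx)
    have h2 : 0 ≤ 1 - x 0 := sub_nonneg.2 (stdSimplex.le_one x 0)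
    refine ⟨(t, ⟨fun j => x j.succ / (1 - x 0), fun j => div_nonneg (x.2.1 _) h2, ?_⟩), ?_⟩
    · rw [← Finset.sum_div, div_eq_one_iff_eq h0]
      linarith
    · ext j
      refine Fin.cases rfl (fun j => ?_) j
      rw [stdJoin_succ]
      exact mul_div_cancel₀ _ h0

/-- A continuous surjection from a compact space to a Hausdorff space is a quotient map; cones can
therefore be defined on `[0, 1] × Δⁿ` and descended. -/
lemma isQuotientMap_stdJoin (n : ℕ) : Topology.IsQuotientMap (stdJoin n) :=
  (stdJoin n).continuous.isClosedMap.isQuotientMap (stdJoin n).continuous (stdJoin_surjective n)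

lemma stdFace_zero_eq (n : ℕ) (s : stdSimplex ℝ (Fin (n + 1))) :
    stdFace n 0 s = stdJoin n (0, s) := by
  ext j
  refine Fin.cases ?_ (fun j => ?_) j
  · rw [stdFace_apply_self]; simp
  · rw [← Fin.zero_succAbove, stdFace_apply_succAbove]; simp

lemma stdFace_succ_stdJoin (n : ℕ) (i : Fin (n + 2)) (t : unitInterval)
    (s : stdSimplex ℝ (Fin (n + 1))) :
    stdFace (n + 1) i.succ (stdJoin n (t, s)) = stdJoin (n + 1) (t, stdFace n i s) := by
  ext j
  refine Fin.cases ?_ (fun j => ?_) j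
  · conv_lhs => rw [← Fin.succ_succAbove_zero i]
    rw [stdFace_apply_succAbove]; simp
  · rw [stdJoin_succ]
    rcases Fin.eq_self_or_eq_succAbove i j with rfl | ⟨j, rfl⟩
    · rw [stdFace_apply_self, stdFace_apply_self, mul_zero]
    · rw [stdFace_apply_succAbove, ← Fin.succ_succAbove_succ, stdFace_apply_succAbove]
      simp

lemma stdFace_one_eq (s : stdSimplex ℝ (Fin 1)) : stdFace 0 1 s = stdJoin 0 (1, s) := by
  ext j
  refine Fin.cases ?_ (fun j => ?_) j
  · have := stdFace_apply_succAbove 0 1 s 0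
    simpa using this
  · have : j.succ = 1 := by rw [Subsingleton.elim j 0]; rfl
    rw [stdJoin_succ, this, stdFace_apply_self]
    simp

/-- A contraction of a space to a point. -/
structure Contraction (Y : Type v) [TopologicalSpace Y] where
  /-- The homotopy. -/
  homotopy : C(unitInterval × Y, Y)
  /-- The point to which the space is contracted. -/
  point : Y
  homotopy_zero : ∀ y, homotopy (0, y) = y
  homotopy_one : ∀ y, homotopy (1, y) = point

/-- The contraction of a convex set to one of its points. -/
def Contraction.ofConvex {V : Type v} [AddCommGroup V] [Module ℝ V] [TopologicalSpace V]
    [ContinuousAdd V] [ContinuousSMul ℝ V] {K : Set V} (hK : Convex ℝ K) (p : K) :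
    Contraction K where
  homotopy := ⟨fun x => ⟨(x.1 : ℝ) • (p : V) + (1 - (x.1 : ℝ)) • (x.2 : V),
    hK p.2 x.2.2 x.1.2.1 (sub_nonneg.2 x.1.2.2) (by ring)⟩, by fun_prop⟩
  point := p
  homotopy_zero y := by ext; simp
  homotopy_one y := by ext; simp

namespace Contraction

variable {Y : Type v} [TopologicalSpace Y] (h : Contraction Y)

/-- The only identification made by `stdJoin` is the collapse of `{1} × Δⁿ` to the vertex, and there
the homotopy is constant. -/
lemma factorsThrough_stdJoin {n : ℕ} (σ : C(stdSimplex ℝ (Fin (n + 1)), Y)) :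
    Function.FactorsThrough (h.homotopy.comp ((ContinuousMap.id unitInterval).prodMap σ))
      (stdJoin n) := by
  rintro ⟨t, s⟩ ⟨t', s'⟩ hq
  have h0 : t = t' := Subtype.ext (congrArg (fun x : stdSimplex ℝ (Fin (n + 1 + 1)) => x 0) hq)
  subst h0
  by_cases ht : t = 1
  · subst ht
    simp [h.homotopy_one]
  · have : s = s' := by
      ext j
      have := congrArg (fun x : stdSimplex ℝ (Fin (n + 1 + 1)) => x j.succ) hq
      simp only [stdJoin_succ] at this
      exact mul_left_cancel₀ (sub_ne_zero.2 fun e => ht (Subtype.ext e.symm)) this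
    rw [this]

/-- The cone over a singular simplex. -/
def coneSimplex {n : ℕ} (σ : C(stdSimplex ℝ (Fin (n + 1)), Y)) :
    C(stdSimplex ℝ (Fin (n + 1 + 1)), Y) :=
  (isQuotientMap_stdJoin n).lift (h.homotopy.comp ((ContinuousMap.id unitInterval).prodMap σ))
    (h.factorsThrough_stdJoin σ)

@[simp] lemma coneSimplex_stdJoin {n : ℕ} (σ : C(stdSimplex ℝ (Fin (n + 1)), Y)) (t : unitInterval)
    (s : stdSimplex ℝ (Fin (n + 1))) :
    h.coneSimplex σ (stdJoin n (t, s)) = h.homotopy (t, σ s) :=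
  congrArg (fun g => g (t, s)) ((isQuotientMap_stdJoin n).lift_comp
    (h.homotopy.comp ((ContinuousMap.id unitInterval).prodMap σ)) (h.factorsThrough_stdJoin σ))

lemma coneSimplex_comp_stdFace_zero {n : ℕ} (σ : C(stdSimplex ℝ (Fin (n + 1)), Y)) :
    (h.coneSimplex σ).comp (stdFace n 0) = σ := by
  ext s
  rw [ContinuousMap.comp_apply, stdFace_zero_eq, coneSimplex_stdJoin, h.homotopy_zero]

lemma coneSimplex_comp_stdFace_succ {n : ℕ} (σ : C(stdSimplex ℝ (Fin (n + 1 + 1)), Y))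
    (i : Fin (n + 2)) :
    (h.coneSimplex σ).comp (stdFace (n + 1) i.succ) = h.coneSimplex (σ.comp (stdFace n i)) := by
  ext x
  obtain ⟨⟨t, s⟩, rfl⟩ := stdJoin_surjective n x
  rw [ContinuousMap.comp_apply, stdFace_succ_stdJoin, coneSimplex_stdJoin, coneSimplex_stdJoin,
    ContinuousMap.comp_apply]

lemma coneSimplex_comp_stdFace_one (σ : C(stdSimplex ℝ (Fin 1), Y)) :
    (h.coneSimplex σ).comp (stdFace 0 1) = ContinuousMap.const _ h.point := by
  ext s
  rw [ContinuousMap.comp_apply, stdFace_one_eq, coneSimplex_stdJoin, h.homotopy_one]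
  rfl

variable {κ : Type k} [Field κ]

/-- The cone over a singular chain. -/
def cone (n : ℕ) : SingChain κ n Y →ₗ[κ] SingChain κ (n + 1) Y :=
  Finsupp.lmapDomain κ κ h.coneSimplex

@[simp] lemma cone_single (n : ℕ) (σ : C(stdSimplex ℝ (Fin (n + 1)), Y)) (c : κ) :
    h.cone n (Finsupp.single σ c) = Finsupp.single (h.coneSimplex σ) c := by
  simp [cone]

/-- The zeroth face of a cone is its base; the other faces are the cones over the faces of the base,
with sign shifted by one. -/
lemma boundary_cone (n : ℕ) (c : SingChain κ (n + 1) Y) :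
    SingChain.boundary (n + 1) Y (h.cone (n + 1) c) = c - h.cone n (SingChain.boundary n Y c) := by
  induction c using Finsupp.induction_linear with
  | zero => simp
  | add a b ha hb => simp only [map_add, ha, hb]; abel
  | single σ c =>
    rw [cone_single, SingChain.boundary_single, SingChain.boundary_single, Fin.sum_univ_succ,
      coneSimplex_comp_stdFace_zero, smul_add, map_smul, map_sum, sub_eq_add_neg]
    congr 1
    · simp
    · rw [← smul_neg, ← Finset.sum_neg_distrib]
      congr 1
      refine Finset.sum_congr rfl fun i _ => ?_
      rw [coneSimplex_comp_stdFace_succ, map_smul, cone_single]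
      simp [pow_succ]

/-- The augmentation of singular `0`-chains. -/
def _root_.SingChain.augmentation (n : ℕ) (Y : Type v) [TopologicalSpace Y] :
    SingChain κ n Y →ₗ[κ] κ :=
  Finsupp.linearCombination κ fun _ => 1

/-- The base is now a point, so the second face is the apex instead of a smaller cone; this is where
the augmentation enters. -/
lemma boundary_cone_zero (c : SingChain κ 0 Y) :
    SingChain.boundary 0 Y (h.cone 0 c) =
      c - Finsupp.single (ContinuousMap.const _ h.point) (SingChain.augmentation 0 Y c) := by
  induction c using Finsupp.induction_linear with
  | zero => simp
  | add a b ha hb => simp only [map_add, ha, hb, Finsupp.single_add]; abel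
  | single σ c =>
    rw [cone_single, SingChain.boundary_single, Fin.sum_univ_two,
      coneSimplex_comp_stdFace_zero, coneSimplex_comp_stdFace_one]
    simp [SingChain.augmentation, sub_eq_add_neg]

end Contraction

/-! ### Barycentric subdivision and its homotopy to the identity -/

namespace SingChain

variable {κ : Type k} [Field κ] {Y : Type v} [TopologicalSpace Y] {Z : Type u} [TopologicalSpace Z]

/-- The natural operator on singular chains given by a chain of the standard simplex. -/
def natOp {m n : ℕ} (c : SingChain κ m (stdSimplex ℝ (Fin (n + 1)))) :
    SingChain κ n Y →ₗ[κ] SingChain κ m Y :=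
  Finsupp.linearCombination κ fun σ => map m σ c

/-- The identity of the standard simplex. -/
def idChain (κ : Type k) [Field κ] (n : ℕ) : SingChain κ n (stdSimplex ℝ (Fin (n + 1))) :=
  Finsupp.single (ContinuousMap.id _) 1

section natOp

variable {m n : ℕ} (c : SingChain κ m (stdSimplex ℝ (Fin (n + 1))))

@[simp] lemma natOp_single (σ : C(stdSimplex ℝ (Fin (n + 1)), Y)) (a : κ) :
    natOp c (Finsupp.single σ a) = a • map m σ c := by
  simp [natOp]

lemma natOp_zero (z : SingChain κ n Y) :
    natOp (0 : SingChain κ m (stdSimplex ℝ (Fin (n + 1)))) z = 0 := by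
  induction z using Finsupp.induction_linear with
  | zero => simp
  | add a b ha hb => simp only [map_add, ha, hb, add_zero]
  | single σ a => rw [natOp_single, map_zero, smul_zero]

lemma map_natOp (g : C(Y, Z)) (z : SingChain κ n Y) :
    map m g (natOp c z) = natOp c (map n g z) := by
  induction z using Finsupp.induction_linear with
  | zero => simp
  | add a b ha hb => simp only [map_add, ha, hb]
  | single σ a => rw [natOp_single, map_smul, map_single, natOp_single, map_comp]

lemma boundary_natOp (c : SingChain κ (m + 1) (stdSimplex ℝ (Fin (n + 1)))) (z : SingChain κ n Y) :
    boundary m Y (natOp c z) = natOp (boundary m _ c) z := by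
  induction z using Finsupp.induction_linear with
  | zero => simp
  | add a b ha hb => simp only [map_add, ha, hb]
  | single σ a => rw [natOp_single, map_smul, natOp_single, map_boundary]

lemma natOp_idChain : natOp c (idChain κ n) = c := by
  rw [idChain, natOp_single, one_smul]
  induction c using Finsupp.induction_linear with
  | zero => simp
  | add a b ha hb => simp only [map_add, ha, hb]
  | single σ a => simp

lemma single_eq_smul_map_idChain (σ : C(stdSimplex ℝ (Fin (n + 1)), Y)) (a : κ) :
    Finsupp.single σ a = a • map n σ (idChain κ n) := by
  simp [idChain]

end natOp

/-- The contraction of the standard simplex to its barycenter. -/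
def barycenterContraction (n : ℕ) : Contraction (stdSimplex ℝ (Fin (n + 1))) :=
  Contraction.ofConvex (convex_stdSimplex ℝ (Fin (n + 1))) stdSimplex.barycenter

/-- The barycentric subdivision of the standard simplex. -/
def sdChain (κ : Type k) [Field κ] : (n : ℕ) → SingChain κ n (stdSimplex ℝ (Fin (n + 1)))
  | 0 => idChain κ 0
  | n + 1 => (barycenterContraction (n + 1)).cone n
      (natOp (sdChain κ n) (boundary n _ (idChain κ (n + 1))))

/-- Barycentric subdivision. -/
def sd (n : ℕ) (Y : Type v) [TopologicalSpace Y] : SingChain κ n Y →ₗ[κ] SingChain κ n Y :=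
  natOp (sdChain κ n)

@[simp] lemma sd_zero (z : SingChain κ 0 Y) : sd 0 Y z = z := by
  induction z using Finsupp.induction_linear with
  | zero => simp
  | add a b ha hb => simp only [map_add, ha, hb]
  | single σ a => rw [sd, natOp_single, sdChain, ← single_eq_smul_map_idChain]

lemma augmentation_boundary (c : SingChain κ 1 Y) :
    augmentation 0 Y (boundary 0 Y c) = 0 := by
  induction c using Finsupp.induction_linear with
  | zero => simp
  | add a b ha hb => simp only [map_add, ha, hb, add_zero]
  | single σ a =>
    rw [boundary_single, Fin.sum_univ_two]
    simp [augmentation]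

/-- Both sides are natural in the space and every simplex is the image of the identity simplex, so
one universal case suffices. -/
lemma boundary_sd_of_idChain {n : ℕ}
    (h : boundary n _ (sdChain κ (n + 1)) = sd n _ (boundary n _ (idChain κ (n + 1))))
    (z : SingChain κ (n + 1) Y) : boundary n Y (sd (n + 1) Y z) = sd n Y (boundary n Y z) := by
  induction z using Finsupp.induction_linear with
  | zero => simp
  | add a b ha hb => simp only [map_add, ha, hb]
  | single σ a =>
    rw [single_eq_smul_map_idChain, map_smul, map_smul, map_smul, map_smul, ← map_boundary, sd, sd,
      ← map_natOp, ← map_natOp, natOp_idChain, ← map_boundary, h, sd]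

lemma boundary_sdChain (n : ℕ) :
    boundary n _ (sdChain κ (n + 1)) = sd n _ (boundary n _ (idChain κ (n + 1))) := by
  induction n with
  | zero =>
    rw [sdChain, Contraction.boundary_cone_zero, ← sd, sd_zero, augmentation_boundary]
    simp
  | succ n ih =>
    rw [sdChain, Contraction.boundary_cone, ← sd, boundary_sd_of_idChain ih, boundary_boundary]
    simp

lemma boundary_sd (n : ℕ) (z : SingChain κ (n + 1) Y) :
    boundary n Y (sd (n + 1) Y z) = sd n Y (boundary n Y z) :=
  boundary_sd_of_idChain (boundary_sdChain n) z

/-- The chain of the standard simplex which defines the homotopy from subdivision to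
the identity. -/
def sdHomotopyChain (κ : Type k) [Field κ] :
    (n : ℕ) → SingChain κ (n + 1) (stdSimplex ℝ (Fin (n + 1)))
  | 0 => 0
  | n + 1 => (barycenterContraction (n + 1)).cone (n + 1)
      (idChain κ (n + 1) - sdChain κ (n + 1) -
        natOp (sdHomotopyChain κ n) (boundary n _ (idChain κ (n + 1))))

lemma boundary_sdHomotopy_of_idChain {n : ℕ}
    (h : boundary (n + 1) _ (sdHomotopyChain κ (n + 1)) = idChain κ (n + 1) - sdChain κ (n + 1) -
        natOp (sdHomotopyChain κ n) (boundary n _ (idChain κ (n + 1))))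
    (z : SingChain κ (n + 1) Y) :
    boundary (n + 1) Y (natOp (sdHomotopyChain κ (n + 1)) z) =
      z - sd (n + 1) Y z - natOp (sdHomotopyChain κ n) (boundary n Y z) := by
  induction z using Finsupp.induction_linear with
  | zero => simp
  | add a b ha hb => simp only [map_add, ha, hb]; abel
  | single σ a =>
    rw [boundary_natOp, h, natOp_single, single_eq_smul_map_idChain, map_smul, map_smul, map_smul,
      ← map_boundary, sd, ← map_natOp, ← map_natOp, natOp_idChain, map_sub, map_sub,
      smul_sub, smul_sub]

/-- By the cone formula the chain being coned only has to be a cycle; `key` is that fact, and it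
follows from the statement one degree lower. -/
lemma boundary_sdHomotopyChain (n : ℕ) :
    boundary (n + 1) _ (sdHomotopyChain κ (n + 1)) = idChain κ (n + 1) - sdChain κ (n + 1) -
        natOp (sdHomotopyChain κ n) (boundary n _ (idChain κ (n + 1))) := by
  have key : boundary n _ (natOp (sdHomotopyChain κ n) (boundary n _ (idChain κ (n + 1)))) =
      boundary n _ (idChain κ (n + 1)) - sd n _ (boundary n _ (idChain κ (n + 1))) := by
    cases n with
    | zero => simp [sdHomotopyChain, natOp_zero]
    | succ n =>
      rw [boundary_sdHomotopy_of_idChain (boundary_sdHomotopyChain n), boundary_boundary]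
      simp
  rw [sdHomotopyChain, Contraction.boundary_cone, map_sub, map_sub, map_sub, boundary_sdChain, key]
  simp

lemma boundary_sdHomotopy_of_mem_cycles {n : ℕ} {z : SingChain κ n Y} (hz : z ∈ cycles κ n Y) :
    boundary n Y (natOp (sdHomotopyChain κ n) z) = z - sd n Y z := by
  cases n with
  | zero => simp [sdHomotopyChain, natOp_zero]
  | succ n =>
    have h : boundary n Y z = 0 := hz
    rw [boundary_sdHomotopy_of_idChain (boundary_sdHomotopyChain n), h]
    simp

lemma sd_mem_cycles {n : ℕ} {z : SingChain κ n Y} (hz : z ∈ cycles κ n Y) :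
    sd n Y z ∈ cycles κ n Y := by
  cases n with
  | zero => trivial
  | succ n =>
    have h : boundary n Y z = 0 := hz
    change boundary n Y _ = 0
    rw [boundary_sd, h, map_zero]

end SingChain

/-! ### Subdivision shrinks simplices -/

/-- A map of standard simplices which is affine and has a coordinate that is bounded below by
`1 / (n + 1)`. -/
def IsAffineMinorized {m n : ℕ} (φ : C(stdSimplex ℝ (Fin (m + 1)), stdSimplex ℝ (Fin (n + 1)))) :
    Prop :=
  (∃ M : Fin (m + 1) → Fin (n + 1) → ℝ, ∀ x k, φ x k = ∑ j, x j * M j k) ∧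
    ∃ i, ∀ x, 1 / ((n : ℝ) + 1) ≤ φ x i

/-- All barycentric coordinates of the apex are `1 / (n + 2)`, and on the base some fixed coordinate
is at least `1 / (n + 1)`; convex combinations keep that coordinate above the smaller bound. -/
lemma IsAffineMinorized.coneSimplex_stdFace {m n : ℕ}
    {φ : C(stdSimplex ℝ (Fin (m + 1)), stdSimplex ℝ (Fin (n + 1)))} (hφ : IsAffineMinorized φ)
    (i : Fin (n + 2)) :
    IsAffineMinorized ((SingChain.barycenterContraction (n + 1)).coneSimplex
      ((stdFace n i).comp φ)) := by
  obtain ⟨⟨M, hM⟩, i₀, hi₀⟩ := hφ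
  have hcone : ∀ t s k, (SingChain.barycenterContraction (n + 1)).coneSimplex
      ((stdFace n i).comp φ) (stdJoin m (t, s)) k =
      t * (1 / ((n : ℝ) + 2)) + (1 - t) * stdFace n i (φ s) k := by
    intro t s k
    rw [Contraction.coneSimplex_stdJoin]
    change t * ((Fintype.card (Fin (n + 1 + 1)) : ℝ)⁻¹) + (1 - t) * stdFace n i (φ s) k = _
    congr 2
    rw [Fintype.card_fin]
    push_cast
    rw [one_div]
    congr 1
    ring
  constructor
  · refine ⟨Fin.cons (fun _ => 1 / ((n : ℝ) + 2))
      (fun j => i.insertNth (α := fun _ => ℝ) 0 (M j)), fun x k => ?_⟩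
    obtain ⟨⟨t, s⟩, rfl⟩ := stdJoin_surjective m x
    rw [hcone, Fin.sum_univ_succ]
    congr 1
    simp only [stdJoin_succ, Fin.cons_succ, mul_assoc]
    rw [← Finset.mul_sum]
    congr 1
    rcases Fin.eq_self_or_eq_succAbove i k with rfl | ⟨k, rfl⟩
    · rw [stdFace_apply_self]
      simp
    · rw [stdFace_apply_succAbove, hM]
      simp
  · refine ⟨i.succAbove i₀, fun x => ?_⟩
    obtain ⟨⟨t, s⟩, rfl⟩ := stdJoin_surjective m x
    rw [hcone, stdFace_apply_succAbove]
    have h1 : 1 / ((n : ℝ) + 2) ≤ 1 / ((n : ℝ) + 1) := by gcongr; norm_num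
    have h2 := mul_le_mul_of_nonneg_left (h1.trans (hi₀ s)) (sub_nonneg.2 t.2.2)
    have h3 : 1 / (((n + 1 : ℕ) : ℝ) + 1) = 1 / ((n : ℝ) + 2) := by push_cast; congr 1; ring
    rw [h3]
    linarith

/-- Doeblin's argument: `φ` is a stochastic matrix whose rows share mass `ε` at the entry `i`.
Removing it does not change differences of values, and leaves nonnegative rows of mass `1 - ε`,
which contract the `ℓ¹` distance. -/
lemma IsAffineMinorized.sum_abs_sub_le {m n : ℕ}
    {φ : C(stdSimplex ℝ (Fin (m + 1)), stdSimplex ℝ (Fin (n + 1)))} (hφ : IsAffineMinorized φ)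
    (x y : stdSimplex ℝ (Fin (m + 1))) :
    ∑ k, |φ x k - φ y k| ≤ (1 - 1 / ((n : ℝ) + 1)) * ∑ j, |x j - y j| := by
  obtain ⟨⟨M, hM⟩, i, hi⟩ := hφ
  set ε : ℝ := 1 / ((n : ℝ) + 1)
  have hvertex : ∀ j k, φ (stdSimplex.vertex j) k = M j k := by
    intro j k
    rw [hM, Finset.sum_eq_single j]
    · simp
    · intro b _ hb
      simp [Pi.single_eq_of_ne hb]
    · simp
  have hsum : ∀ j, ∑ k, M j k = 1 := by
    intro j
    simp only [← hvertex]
    exact stdSimplex.sum_eq_one _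
  let N : Fin (m + 1) → Fin (n + 1) → ℝ := fun j k => M j k - if k = i then ε else 0
  have hN : ∀ j k, 0 ≤ N j k := by
    intro j k
    simp only [N]
    split_ifs with h
    · subst h
      rw [← hvertex]
      exact sub_nonneg.2 (hi _)
    · rw [← hvertex, sub_zero]
      exact (φ (stdSimplex.vertex j)).2.1 k
  have hNsum : ∀ j, ∑ k, N j k = 1 - ε := by
    intro j
    simp [N, Finset.sum_sub_distrib, hsum]
  have hdiff : ∀ k, φ x k - φ y k = ∑ j, (x j - y j) * N j k := by
    intro k
    have h0 : ∑ j, (x j - y j) = 0 := by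
      rw [Finset.sum_sub_distrib, stdSimplex.sum_eq_one, stdSimplex.sum_eq_one, sub_self]
    simp only [N, mul_sub]
    rw [Finset.sum_sub_distrib, ← Finset.sum_mul, h0, zero_mul, sub_zero, hM, hM,
      ← Finset.sum_sub_distrib]
    simp only [sub_mul]
  calc ∑ k, |φ x k - φ y k| ≤ ∑ k, ∑ j, |x j - y j| * N j k := by
        refine Finset.sum_le_sum fun k _ => ?_
        rw [hdiff]
        refine (Finset.abs_sum_le_sum_abs _ _).trans (Finset.sum_le_sum fun j _ => ?_)
        rw [abs_mul, abs_of_nonneg (hN j k)]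
    _ = (1 - ε) * ∑ j, |x j - y j| := by
        rw [Finset.sum_comm, Finset.mul_sum]
        refine Finset.sum_congr rfl fun j _ => ?_
        rw [← Finset.mul_sum, hNsum, mul_comm]

namespace SingChain

variable {κ : Type k} [Field κ] {Y : Type v} [TopologicalSpace Y] {Z : Type u} [TopologicalSpace Z]

lemma lmapDomain_mem_supported {α β : Type*} (f : α → β) {s : Set α} {t : Set β}
    (h : ∀ a ∈ s, f a ∈ t) {c : α →₀ κ} (hc : c ∈ Finsupp.supported κ κ s) :
    Finsupp.lmapDomain κ κ f c ∈ Finsupp.supported κ κ t := by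
  rw [Finsupp.mem_supported] at hc ⊢
  classical
  intro b hb
  obtain ⟨a, ha, rfl⟩ := Finset.mem_image.1 (Finsupp.mapDomain_support hb)
  exact h a (hc ha)

lemma linearCombination_mem {α : Type*} {M : Type*} [AddCommGroup M] [Module κ M]
    (f : α → M) {s : Set α} {P : Submodule κ M} (h : ∀ a ∈ s, f a ∈ P) {c : α →₀ κ}
    (hc : c ∈ Finsupp.supported κ κ s) : Finsupp.linearCombination κ f c ∈ P :=
  P.sum_mem fun a ha => P.smul_mem _ (h a (hc ha))

lemma natOp_mem_supported {m n : ℕ} {c : SingChain κ m (stdSimplex ℝ (Fin (n + 1)))}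
    {P : Set C(stdSimplex ℝ (Fin (m + 1)), stdSimplex ℝ (Fin (n + 1)))}
    (hc : c ∈ Finsupp.supported κ κ P) {z : SingChain κ n Y}
    {s : Set C(stdSimplex ℝ (Fin (n + 1)), Y)} {t : Set C(stdSimplex ℝ (Fin (m + 1)), Y)}
    (h : ∀ σ ∈ s, ∀ φ ∈ P, σ.comp φ ∈ t) (hz : z ∈ Finsupp.supported κ κ s) :
    natOp c z ∈ Finsupp.supported κ κ t :=
  linearCombination_mem _ (fun σ hσ => lmapDomain_mem_supported _ (h σ hσ) hc) hz

lemma sdChain_mem_supported (n : ℕ) :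
    sdChain κ n ∈ Finsupp.supported κ κ {φ | IsAffineMinorized φ} := by
  induction n with
  | zero =>
    refine Finsupp.single_mem_supported _ _ ⟨⟨fun _ _ => 1, fun x k => ?_⟩, 0, fun x => ?_⟩
    · have hk : k = 0 := Fin.fin_one_eq_zero k
      subst hk
      simp
    · simp
  | succ n ih =>
    rw [sdChain]
    refine lmapDomain_mem_supported (s := {τ | ∃ i φ, IsAffineMinorized φ ∧
      τ = (stdFace n i).comp φ}) _ ?_ ?_
    · rintro _ ⟨i, φ, hφ, rfl⟩
      exact hφ.coneSimplex_stdFace i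
    · refine natOp_mem_supported ih (s := Set.range (stdFace n)) ?_ ?_
      · rintro _ ⟨i, rfl⟩ φ hφ
        exact ⟨i, φ, hφ, rfl⟩
      · rw [idChain, boundary_single]
        refine Submodule.smul_mem _ _ (Submodule.sum_mem _ fun i _ => Submodule.smul_mem _ _ ?_)
        exact Finsupp.single_mem_supported _ _ ⟨i, rfl⟩

lemma sd_iterate_single_mem_supported (n j : ℕ) (σ : C(stdSimplex ℝ (Fin (n + 1)), Y)) (a : κ) :
    (sd n Y)^[j] (Finsupp.single σ a) ∈ Finsupp.supported κ κ
      {τ | ∃ ψ : C(stdSimplex ℝ (Fin (n + 1)), stdSimplex ℝ (Fin (n + 1))), τ = σ.comp ψ ∧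
        ∀ x y, ∑ i, |ψ x i - ψ y i| ≤ (1 - 1 / ((n : ℝ) + 1)) ^ j * ∑ i, |x i - y i|} := by
  induction j with
  | zero =>
    refine Finsupp.single_mem_supported _ _ ⟨ContinuousMap.id _, rfl, fun x y => ?_⟩
    simp
  | succ j ih =>
    rw [Function.iterate_succ_apply', sd]
    refine natOp_mem_supported (sdChain_mem_supported n) ?_ ih
    rintro _ ⟨ψ, rfl, hψ⟩ φ hφ
    refine ⟨ψ.comp φ, rfl, fun x y => ?_⟩
    refine (hψ (φ x) (φ y)).trans ?_
    rw [pow_succ, mul_assoc]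
    refine mul_le_mul_of_nonneg_left (hφ.sum_abs_sub_le x y) (pow_nonneg ?_ _)
    rw [sub_nonneg, div_le_one (by positivity)]
    linarith [Nat.cast_nonneg (α := ℝ) n]

/-- The chains all whose simplices are contained in a member of a family of sets. -/
def small {ι : Type*} (κ : Type k) [Field κ] (n : ℕ) (U : ι → Set Y) :
    Submodule κ (SingChain κ n Y) :=
  Finsupp.supported κ κ {σ | ∃ i, ∀ x, σ x ∈ U i}

lemma boundary_mem_small {ι : Type*} {U : ι → Set Y} {n : ℕ} {z : SingChain κ (n + 1) Y}
    (hz : z ∈ small κ (n + 1) U) : boundary n Y z ∈ small κ n U := by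
  refine linearCombination_mem _ ?_ hz
  rintro σ ⟨i, hi⟩
  refine Submodule.sum_mem _ fun j _ => Submodule.smul_mem _ _ ?_
  exact Finsupp.single_mem_supported _ _ ⟨i, fun _ => hi _⟩

/-- Pull the cover back to the simplex and take a Lebesgue number; the pieces of the iterated
subdivision eventually have smaller size. A chain has finitely many simplices, so one `j` serves
them all. -/
lemma eventually_sd_iterate_mem_small {ι : Type*} {U : ι → Set Y} (hU : ∀ i, IsOpen (U i)) {n : ℕ}
    {c : SingChain κ n Y}
    (hc : c ∈ Finsupp.supported κ κ {σ | ∀ x, ∃ i, σ x ∈ U i}) :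
    ∀ᶠ j in Filter.atTop, (sd n Y)^[j] c ∈ small κ n U := by
  have hadd : ∀ j : ℕ, ∀ s : Finset C(stdSimplex ℝ (Fin (n + 1)), Y),
      (sd n Y)^[j] (∑ σ ∈ s, Finsupp.single σ (c σ)) =
        ∑ σ ∈ s, (sd n Y)^[j] (Finsupp.single σ (c σ)) := by
    intro j s
    simp only [← Module.End.pow_apply, map_sum]
  have hsingle : ∀ σ ∈ c.support, ∀ᶠ j in Filter.atTop,
      (sd n Y)^[j] (Finsupp.single σ (c σ)) ∈ small κ n U := by
    intro σ hσ
    obtain ⟨δ, hδ, hball⟩ := lebesgue_number_lemma_of_metric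
      (isCompact_univ (X := stdSimplex ℝ (Fin (n + 1))))
      (c := fun i => σ ⁻¹' U i) (fun i => (hU i).preimage σ.continuous)
      (fun x _ => Set.mem_iUnion.2 (hc hσ x))
    have hlim : Filter.Tendsto (fun j : ℕ => (1 - 1 / ((n : ℝ) + 1)) ^ j * 2) Filter.atTop
        (nhds (0 * 2)) := by
      refine (tendsto_pow_atTop_nhds_zero_of_lt_one ?_ ?_).mul_const 2
      · rw [sub_nonneg, div_le_one (by positivity)]
        linarith [Nat.cast_nonneg (α := ℝ) n]
      · have : 0 < 1 / ((n : ℝ) + 1) := by positivity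
        linarith
    rw [zero_mul] at hlim
    filter_upwards [hlim.eventually_lt_const hδ] with j hj
    refine Finsupp.supported_mono ?_ (sd_iterate_single_mem_supported n j σ (c σ))
    rintro _ ⟨ψ, rfl, hψ⟩
    obtain ⟨i, hi⟩ := hball (ψ stdSimplex.barycenter) (Set.mem_univ _)
    refine ⟨i, fun x => hi ?_⟩
    rw [Metric.mem_ball]
    refine lt_of_le_of_lt ?_ hj
    have h2 : ∑ i, |x i - stdSimplex.barycenter i| ≤ 2 := by
      calc ∑ i, |x i - stdSimplex.barycenter i| ≤ ∑ i, (x i + stdSimplex.barycenter (𝕜 := ℝ) i) := by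
            refine Finset.sum_le_sum fun i _ => ?_
            have hx : 0 ≤ x i := x.2.1 i
            have hb : 0 ≤ stdSimplex.barycenter (𝕜 := ℝ) i :=
              (stdSimplex.barycenter (𝕜 := ℝ) (X := Fin (n + 1))).2.1 i
            rw [abs_sub_le_iff]
            constructor <;> linarith
        _ = 2 := by
            rw [Finset.sum_add_distrib, stdSimplex.sum_eq_one, stdSimplex.sum_eq_one]; norm_num
    refine le_trans ?_ ((hψ x stdSimplex.barycenter).trans
      (mul_le_mul_of_nonneg_left h2 (pow_nonneg ?_ _)))
    -- The metric on the simplex is the sup metric, which is bounded by the `ℓ¹` distance.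
    · rw [Subtype.dist_eq, dist_pi_le_iff (Finset.sum_nonneg fun _ _ => abs_nonneg _)]
      intro k
      exact Finset.single_le_sum (f := fun k => |ψ x k - ψ stdSimplex.barycenter k|)
        (fun _ _ => abs_nonneg _) (Finset.mem_univ k)
    · rw [sub_nonneg, div_le_one (by positivity)]
      linarith [Nat.cast_nonneg (α := ℝ) n]
  have hall := (Filter.eventually_all_finset c.support).2 hsingle
  filter_upwards [hall] with j hj
  rw [← Finsupp.sum_single c, Finsupp.sum, hadd]
  exact Submodule.sum_mem _ hj

end SingChain

/-! ### Mayer-Vietoris and finiteness of homology -/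

/-- Modulo `Q` the image of `W` is finite-dimensional, so finitely many elements of `W` already
produce it. It serves to choose generators inside a prescribed subspace. -/
lemma Submodule.exists_fg_le_map_le_sup {κ : Type*} [Field κ] {M N : Type*} [AddCommGroup M]
    [Module κ M] [AddCommGroup N] [Module κ N] (f : M →ₗ[κ] N) {W : Submodule κ M}
    {Q G : Submodule κ N} (hG : G.FG) (h : W.map f ≤ Q ⊔ G) :
    ∃ W' ≤ W, W'.FG ∧ W.map f ≤ Q ⊔ W'.map f := by
  have hle : W.map (Q.mkQ ∘ₗ f) ≤ G.map Q.mkQ := by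
    rw [Submodule.map_comp]
    refine (Submodule.map_mono h).trans ?_
    rw [Submodule.map_sup, Submodule.mkQ_map_self, bot_sup_eq]
  have hfg : (W.map (Q.mkQ ∘ₗ f)).FG := by
    have : FiniteDimensional κ (G.map Q.mkQ) := Module.Finite.iff_fg.2 (hG.map _)
    have := Submodule.finiteDimensional_of_le hle
    exact Module.Finite.iff_fg.1 this
  obtain ⟨s, hs⟩ := hfg
  have hsub : (s : Set (N ⧸ Q)) ⊆ (Q.mkQ ∘ₗ f) '' W := by
    rw [← Submodule.map_coe, ← hs]
    exact Submodule.subset_span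
  classical
  obtain ⟨t, htW, rfl⟩ := Finset.subset_set_image_iff.1 hsub
  refine ⟨Submodule.span κ t, Submodule.span_le.2 htW, ⟨t, rfl⟩, ?_⟩
  have heq : (W.map f).map Q.mkQ ≤ ((Submodule.span κ (t : Set M)).map f).map Q.mkQ := by
    rw [← Submodule.map_comp, ← Submodule.map_comp, ← hs, Submodule.map_span, Finset.coe_image]
  have := (Submodule.map_le_iff_le_comap.1 heq)
  rwa [Submodule.comap_map_mkQ] at this

namespace SingChain

variable {κ : Type k} [Field κ] {Y : Type v} [TopologicalSpace Y] {Z : Type u} [TopologicalSpace Z]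

lemma sd_iterate_mem_cycles {n : ℕ} {z : SingChain κ n Y} (hz : z ∈ cycles κ n Y) (j : ℕ) :
    (sd n Y)^[j] z ∈ cycles κ n Y := by
  induction j with
  | zero => exact hz
  | succ j ih =>
    rw [Function.iterate_succ_apply']
    exact sd_mem_cycles ih

lemma boundary_sd_iterate {n : ℕ} (w : SingChain κ (n + 1) Y) (j : ℕ) :
    boundary n Y ((sd (n + 1) Y)^[j] w) = (sd n Y)^[j] (boundary n Y w) := by
  induction j with
  | zero => rfl
  | succ j ih =>
    rw [Function.iterate_succ_apply', Function.iterate_succ_apply', boundary_sd, ih]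

lemma exists_boundary_eq_sub_sd_iterate {n : ℕ} {z : SingChain κ n Y} (hz : z ∈ cycles κ n Y)
    (j : ℕ) : ∃ w, boundary n Y w = z - (sd n Y)^[j] z := by
  induction j with
  | zero => exact ⟨0, by simp⟩
  | succ j ih =>
    obtain ⟨w, hw⟩ := ih
    refine ⟨w + natOp (sdHomotopyChain κ n) ((sd n Y)^[j] z), ?_⟩
    rw [map_add, hw, boundary_sdHomotopy_of_mem_cycles (sd_iterate_mem_cycles hz j),
      Function.iterate_succ_apply']
    abel

/-- The chains all whose simplices are contained in a set. -/
def inside (κ : Type k) [Field κ] (n : ℕ) (A : Set Y) : Submodule κ (SingChain κ n Y) :=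
  Finsupp.supported κ κ {σ | ∀ x, σ x ∈ A}

lemma boundary_mem_inside {n : ℕ} {A : Set Y} {z : SingChain κ (n + 1) Y}
    (hz : z ∈ inside κ (n + 1) A) : boundary n Y z ∈ inside κ n A := by
  refine linearCombination_mem _ (fun σ hσ => ?_) hz
  refine Submodule.sum_mem _ fun j _ => Submodule.smul_mem _ _ ?_
  exact Finsupp.single_mem_supported _ _ fun _ => hσ _

lemma sd_mem_inside {n : ℕ} {A : Set Y} {z : SingChain κ n Y} (hz : z ∈ inside κ n A) :
    sd n Y z ∈ inside κ n A :=
  natOp_mem_supported (P := Set.univ) (by simp) (by intro σ h φ _ x; exact h _) hz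

lemma sd_iterate_mem_inside {n : ℕ} {A : Set Y} {z : SingChain κ n Y} (hz : z ∈ inside κ n A)
    (j : ℕ) : (sd n Y)^[j] z ∈ inside κ n A := by
  induction j with
  | zero => exact hz
  | succ j ih =>
    rw [Function.iterate_succ_apply']
    exact sd_mem_inside ih

lemma inside_mono {n : ℕ} {A B : Set Y} (h : A ⊆ B) : inside κ n A ≤ inside κ n B :=
  Finsupp.supported_mono fun _ hσ x => h (hσ x)

lemma inside_inter {n : ℕ} (A B : Set Y) :
    inside κ n A ⊓ inside κ n B = inside κ n (A ∩ B) := by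
  rw [inside, inside, ← Finsupp.supported_inter, inside]
  congr 1
  ext σ
  exact forall_and.symm

lemma small_inter_inside {n m : ℕ} (U : Fin m → Set Y) (A : Set Y) :
    small κ n U ⊓ inside κ n A = small κ n (fun i => U i ∩ A) := by
  rw [small, inside, ← Finsupp.supported_inter, small]
  congr 1
  ext σ
  constructor
  · rintro ⟨⟨i, hi⟩, h⟩
    exact ⟨i, fun x => ⟨hi x, h x⟩⟩
  · rintro ⟨i, hi⟩
    exact ⟨⟨i, fun x => (hi x).1⟩, fun x => (hi x).2⟩

lemma small_succ {n m : ℕ} (U : Fin (m + 1) → Set Y) :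
    small κ n U = small κ n (fun i => U (Fin.succ i)) ⊔ inside κ n (U 0) := by
  rw [small, small, inside, ← Finsupp.supported_union]
  congr 1
  ext σ
  constructor
  · rintro ⟨i, hi⟩
    rcases Fin.eq_zero_or_eq_succ i with rfl | ⟨i, rfl⟩
    exacts [Or.inr hi, Or.inl ⟨i, hi⟩]
  · rintro (⟨i, hi⟩ | h)
    exacts [⟨_, hi⟩, ⟨_, h⟩]

lemma small_of_isEmpty {n : ℕ} (U : Fin 0 → Set Y) : small κ n U = ⊥ := by
  rw [small, eq_bot_iff]
  rintro z hz
  rw [Finsupp.mem_supported] at hz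
  rw [Submodule.mem_bot, ← Finsupp.support_eq_empty, Finset.eq_empty_iff_forall_notMem]
  intro σ hσ
  obtain ⟨i, -⟩ := hz hσ
  exact i.elim0

lemma inside_eq_range_map {n : ℕ} (A : Set Y) :
    inside κ n A = LinearMap.range (map (κ := κ) n
      ⟨Subtype.val, continuous_subtype_val (p := (· ∈ A))⟩) := by
  apply le_antisymm
  · intro z hz
    rw [← Finsupp.sum_single z]
    refine Submodule.sum_mem _ fun σ hσ => ?_
    exact ⟨Finsupp.single (⟨fun x => ⟨σ x, hz hσ x⟩, by fun_prop⟩) (z σ), by rw [map_single]; rfl⟩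
  · rintro _ ⟨z, rfl⟩
    exact lmapDomain_mem_supported (s := Set.univ) _ (fun σ _ x => (σ x).2) (by simp)

lemma map_injective {n : ℕ} {g : C(Y, Z)} (hg : Function.Injective g) :
    Function.Injective (map (κ := κ) n g) :=
  Finsupp.mapDomain_injective fun _ _ h => ContinuousMap.ext fun x => hg (DFunLike.congr_fun h x)

lemma mem_cycles_of_map {n : ℕ} {g : C(Y, Z)} (hg : Function.Injective g) {z : SingChain κ n Y}
    (hz : map n g z ∈ cycles κ n Z) : z ∈ cycles κ n Y := by
  cases n with
  | zero => trivial
  | succ n =>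
    have h : boundary n Z (map (n + 1) g z) = 0 := hz
    refine map_injective (κ := κ) (n := n) hg ?_
    rw [map_boundary, h, map_zero]

/-- The Mayer-Vietoris property: a class coming from both `A` and `B` comes from `A ∩ B`. -/
lemma exists_mem_inside_inter {n : ℕ} {A B : Set Y} (hAB : interior A ∪ interior B = Set.univ)
    {a b : SingChain κ n Y} (ha : a ∈ inside κ n A) (hb : b ∈ inside κ n B)
    (hac : a ∈ cycles κ n Y) (w : SingChain κ (n + 1) Y) (hw : boundary n Y w = a - b) :
    ∃ z ∈ inside κ n (A ∩ B), ∃ w', boundary n Y w' = a - z := by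
  -- Subdivide `w` until it splits as `wB + wA`, with pieces inside `B` and `A`.
  obtain ⟨j, hj⟩ := (eventually_sd_iterate_mem_small (κ := κ) (n := n + 1) (c := w)
    (U := ![interior A, interior B])
    (by intro i; fin_cases i; exacts [isOpen_interior, isOpen_interior]) (by
      intro σ _ x
      rcases (hAB.symm ▸ Set.mem_univ (σ x) : σ x ∈ interior A ∪ interior B) with h | h
      exacts [⟨0, h⟩, ⟨1, h⟩])).exists
  rw [small_succ, small_succ, small_of_isEmpty, bot_sup_eq, Submodule.mem_sup] at hj
  obtain ⟨wB, hwB, wA, hwA, hwAB⟩ := hj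
  replace hwA : wA ∈ inside κ (n + 1) A := inside_mono interior_subset hwA
  replace hwB : wB ∈ inside κ (n + 1) B := inside_mono interior_subset hwB
  obtain ⟨w₁, hw₁⟩ := exists_boundary_eq_sub_sd_iterate hac j
  have hkey : boundary n Y wB + boundary n Y wA = (sd n Y)^[j] a - (sd n Y)^[j] b := by
    rw [← map_add, hwAB, boundary_sd_iterate, hw, ← Module.End.pow_apply, map_sub,
      Module.End.pow_apply, Module.End.pow_apply]
  -- This chain is visibly inside `A`, and it equals `sd^j b + ∂ wB`, which is inside `B`.
  refine ⟨(sd n Y)^[j] a - boundary n Y wA, ?_, w₁ + wA, ?_⟩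
  · rw [← inside_inter]
    refine ⟨Submodule.sub_mem _ (sd_iterate_mem_inside ha j) (boundary_mem_inside hwA), ?_⟩
    have : (sd n Y)^[j] a - boundary n Y wA = (sd n Y)^[j] b + boundary n Y wB := by
      rw [sub_eq_iff_eq_add, add_assoc, hkey]; abel
    rw [this]
    exact Submodule.add_mem _ (sd_iterate_mem_inside hb j) (boundary_mem_inside hwB)
  · rw [map_add, hw₁]
    abel

/-- Finite dimensionality of the homology of a graded subspace of the singular chains. -/
def HasFiniteHomology (A : ∀ n, Submodule κ (SingChain κ n Y)) : Prop :=
  ∀ n, ∃ G : Submodule κ (SingChain κ n Y), G.FG ∧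
    cycles κ n Y ⊓ A n ≤ (A (n + 1)).map (boundary n Y) ⊔ G

/-- The Mayer-Vietoris argument at chain level. The connecting map sends a cycle `a + b` to `∂ a`, a
cycle of `A ⊓ B`. Its image is finite-dimensional modulo boundaries, so after subtracting finitely
many lifts (`W'`) every cycle splits into a cycle of `A` and a cycle of `B`. -/
lemma HasFiniteHomology.sup {A B : ∀ n, Submodule κ (SingChain κ n Y)}
    (hAB : HasFiniteHomology fun n => A n ⊓ B n) (hA : HasFiniteHomology A)
    (hB : HasFiniteHomology B) (hdA : ∀ n, (A (n + 1)).map (boundary n Y) ≤ A n)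
    (hdB : ∀ n, (B (n + 1)).map (boundary n Y) ≤ B n) :
    HasFiniteHomology fun n => A n ⊔ B n := by
  intro n
  obtain ⟨GA, hGA, hGA'⟩ := hA n
  obtain ⟨GB, hGB, hGB'⟩ := hB n
  have hA1 : (A (n + 1)).map (boundary n Y) ⊔ GA ≤
      (A (n + 1) ⊔ B (n + 1)).map (boundary n Y) ⊔ (GA ⊔ GB) :=
    sup_le_sup (Submodule.map_mono le_sup_left) le_sup_left
  have hB1 : (B (n + 1)).map (boundary n Y) ⊔ GB ≤
      (A (n + 1) ⊔ B (n + 1)).map (boundary n Y) ⊔ (GA ⊔ GB) :=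
    sup_le_sup (Submodule.map_mono le_sup_right) le_sup_right
  cases n with
  -- Every `0`-chain is a cycle, so there is no connecting map to deal with.
  | zero =>
    refine ⟨GA ⊔ GB, hGA.sup hGB, ?_⟩
    rintro z ⟨-, hz⟩
    obtain ⟨a, ha, b, hb, rfl⟩ := Submodule.mem_sup.1 hz
    exact Submodule.add_mem _ (hA1 (hGA' ⟨trivial, ha⟩)) (hB1 (hGB' ⟨trivial, hb⟩))
  | succ n =>
    obtain ⟨G, hG, hG'⟩ := hAB n
    let P := SingChain κ (n + 1) Y × SingChain κ (n + 1) Y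
    let W : Submodule κ P := (A (n + 1)).prod (B (n + 1)) ⊓
      LinearMap.ker (boundary n Y ∘ₗ (LinearMap.fst κ _ _ + LinearMap.snd κ _ _))
    have hW : W.map (boundary n Y ∘ₗ LinearMap.fst κ _ _) ≤
        (A (n + 1) ⊓ B (n + 1)).map (boundary n Y) ⊔ G := by
      refine le_trans ?_ hG'
      rintro _ ⟨⟨a, b⟩, ⟨⟨ha, hb⟩, hab⟩, rfl⟩
      have hab' : boundary n Y a + boundary n Y b = 0 := by
        rw [← map_add]; exact hab
      refine ⟨boundary_mem_cycles a, hdA n ⟨a, ha, rfl⟩, ?_⟩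
      change boundary n Y a ∈ B n
      rw [eq_neg_of_add_eq_zero_left hab']
      exact Submodule.neg_mem _ (hdB n ⟨b, hb, rfl⟩)
    obtain ⟨W', hW'W, hW', hWW'⟩ := Submodule.exists_fg_le_map_le_sup _ hG hW
    refine ⟨(GA ⊔ GB) ⊔ W'.map (LinearMap.fst κ _ _ + LinearMap.snd κ _ _),
      (hGA.sup hGB).sup (hW'.map _), ?_⟩
    rintro z ⟨hzc, hz⟩
    obtain ⟨a, ha, b, hb, rfl⟩ := Submodule.mem_sup.1 hz
    have hab : boundary n Y a + boundary n Y b = 0 := by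
      rw [← map_add]; exact hzc
    have habW : (a, b) ∈ W := ⟨⟨ha, hb⟩, hzc⟩
    obtain ⟨_, ⟨c, hc, rfl⟩, _, ⟨⟨a', b'⟩, hW'ab, rfl⟩, hsum⟩ :=
      Submodule.mem_sup.1 (hWW' ⟨_, habW, rfl⟩)
    obtain ⟨⟨ha', hb'⟩, hab'⟩ := hW'W hW'ab
    replace hab' : boundary n Y a' + boundary n Y b' = 0 := by
      rw [← map_add]; exact hab'
    replace hsum : boundary n Y c + boundary n Y a' = boundary n Y a := hsum
    -- Since `∂ a = ∂ a' + ∂ c` with `c` in both `A` and `B`, moving `c` from one summand to the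
    -- other makes both summands cycles.
    have h1 : a - a' - c ∈ cycles κ (n + 1) Y ⊓ A (n + 1) := by
      refine ⟨?_, sub_mem (sub_mem ha ha') hc.1⟩
      change boundary n Y _ = 0
      rw [map_sub, map_sub, ← hsum]
      abel
    have h2 : b - b' + c ∈ cycles κ (n + 1) Y ⊓ B (n + 1) := by
      refine ⟨?_, add_mem (sub_mem hb hb') hc.2⟩
      change boundary n Y _ = 0
      rw [map_add, map_sub, eq_neg_of_add_eq_zero_right hab, eq_neg_of_add_eq_zero_right hab',
        ← hsum]
      abel
    have h3 : a + b = (a - a' - c) + (b - b' + c) + (a' + b') := by abel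
    rw [h3, ← sup_assoc]
    exact Submodule.add_mem_sup (Submodule.add_mem _ (hA1 (hGA' h1)) (hB1 (hGB' h2)))
      ⟨_, hW'ab, rfl⟩

/-- Coning bounds every cycle in positive degree; in degree `0` a multiple of the constant simplex
at the apex remains. -/
lemma hasFiniteHomology_inside_of_contraction {U : Set Y} (h : Contraction U) :
    HasFiniteHomology fun n => inside κ n U := by
  intro n
  let ι : C(U, Y) := ⟨Subtype.val, continuous_subtype_val⟩
  have hι : Function.Injective ι := Subtype.val_injective
  refine ⟨(κ ∙ map n ι (Finsupp.single (ContinuousMap.const _ h.point) 1)),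
    Submodule.fg_span_singleton _, ?_⟩
  rintro z ⟨hzc, hz⟩
  change z ∈ inside κ n U at hz
  rw [inside_eq_range_map] at hz
  obtain ⟨z, rfl⟩ := hz
  have hmem : map (n + 1) ι (h.cone n z) ∈ inside κ (n + 1) U := by
    rw [inside_eq_range_map]; exact ⟨_, rfl⟩
  have hz' := mem_cycles_of_map hι hzc
  cases n with
  | zero =>
    refine Submodule.mem_sup.2 ⟨_, ⟨_, hmem, rfl⟩, _, Submodule.smul_mem _ (augmentation 0 U z)
      (Submodule.mem_span_singleton_self _), ?_⟩
    rw [← map_boundary, h.boundary_cone_zero, ← map_smul, ← map_add]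
    congr 1
    simp
  | succ n =>
    refine Submodule.mem_sup_left ⟨_, hmem, ?_⟩
    have h0 : boundary n U z = 0 := hz'
    rw [← map_boundary, h.boundary_cone, h0, map_zero, sub_zero]

lemma hasFiniteHomology_inside_empty : HasFiniteHomology fun n => inside κ n (∅ : Set Y) := by
  intro n
  refine ⟨⊥, Submodule.fg_bot, ?_⟩
  rintro z ⟨-, hz⟩
  have : z = 0 := by
    rw [← Finsupp.support_eq_empty, Finset.eq_empty_iff_forall_notMem]
    intro σ hσ
    exact hz hσ stdSimplex.barycenter
  rw [this]
  exact Submodule.zero_mem _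

/-- Induction on the number of sets: splitting off `U 0`, the intersection term is again a family of
`m` sets satisfying `P`. -/
lemma hasFiniteHomology_small {P : Set Y → Prop} (hP : ∀ U V, P U → P V → P (U ∩ V))
    (hfin : ∀ U, P U → HasFiniteHomology fun n => inside κ n U) (m : ℕ) :
    ∀ U : Fin m → Set Y, (∀ i, P (U i)) → HasFiniteHomology fun n => small κ n U := by
  induction m with
  | zero =>
    intro U _ n
    refine ⟨⊥, Submodule.fg_bot, ?_⟩
    simp only [small_of_isEmpty, inf_bot_eq]
    exact bot_le
  | succ m ih =>
    intro U hU
    simp only [small_succ]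
    refine HasFiniteHomology.sup ?_ (ih _ fun i => hU _) (hfin _ (hU 0)) ?_ ?_
    · simp only [small_inter_inside]
      exact ih _ fun i => hP _ _ (hU _) (hU _)
    · rintro n _ ⟨z, hz, rfl⟩
      exact boundary_mem_small hz
    · rintro n _ ⟨z, hz, rfl⟩
      exact boundary_mem_inside hz

/-- If the image of a map is covered by finitely many open sets with finite dimensional homology of
all intersections, then the image of the map in homology is finite dimensional. -/
theorem finiteDimensional_range_map {K Y : Type v} [TopologicalSpace K] [TopologicalSpace Y]
    (g : C(K, Y)) {P : Set Y → Prop} (hP : ∀ U V, P U → P V → P (U ∩ V))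
    (hfin : ∀ U, P U → HasFiniteHomology fun n => inside κ n U) {m : ℕ}
    (U : Fin m → Set Y) (hPU : ∀ i, P (U i)) (hU : ∀ i, IsOpen (U i))
    (hg : ∀ x, ∃ i, g x ∈ U i) (n : ℕ) :
    FiniteDimensional κ (LinearMap.range (SingHom.map κ n g)) := by
  obtain ⟨G, hG, hG'⟩ := hasFiniteHomology_small hP hfin m U hPU n
  -- Taking `f = id` replaces `G` by a finitely generated space of cycles, whose homology classes
  -- make sense.
  obtain ⟨W, hWc, hW, hW'⟩ := Submodule.exists_fg_le_map_le_sup LinearMap.id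
    (W := cycles κ n Y ⊓ small κ n U) hG (by rwa [Submodule.map_id])
  rw [Submodule.map_id, Submodule.map_id] at hW'
  have : Module.Finite κ W := Module.Finite.iff_fg.2 hW
  have : Module.Finite κ (W.comap (cycles κ n Y).subtype) :=
    Module.Finite.equiv (Submodule.comapSubtypeEquivOfLe (hWc.trans inf_le_left)).symm
  have : FiniteDimensional κ ((W.comap (cycles κ n Y).subtype).map (homologyClass κ n Y)) :=
    inferInstance
  refine Submodule.finiteDimensional_of_le
    (S₂ := (W.comap (cycles κ n Y).subtype).map (homologyClass κ n Y)) ?_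
  rintro _ ⟨x, rfl⟩
  obtain ⟨z, rfl⟩ := homologyClass_surjective x
  rw [map_homologyClass]
  have hz := map_mem_cycles g z.2
  obtain ⟨j, hj⟩ := (eventually_sd_iterate_mem_small hU (c := map n g z.1)
    (lmapDomain_mem_supported (s := Set.univ) _ (by intro σ _ x; exact hg _) (by simp))).exists
  obtain ⟨w, hw⟩ := exists_boundary_eq_sub_sd_iterate hz j
  have hmem : (sd n Y)^[j] (map n g z.1) ∈
      (small κ (n + 1) U).map (boundary n Y) ⊔ W := hW' ⟨sd_iterate_mem_cycles hz j, hj⟩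
  obtain ⟨_, ⟨w', -, rfl⟩, y, hy, hsum⟩ := Submodule.mem_sup.1 hmem
  refine Submodule.mem_map.2 ⟨⟨y, (hWc hy).1⟩, hy, ?_⟩
  refine homologyClass_eq_of_boundary (w := -(w + w')) ?_
  rw [map_neg, map_add, hw, ← hsum]
  abel

end SingChain

/-! ### Compact sets in open subsets of normed spaces -/

/-- The transport of a contraction along a homeomorphism. -/
def Contraction.ofHomeomorph {Y : Type v} {Z : Type u} [TopologicalSpace Y] [TopologicalSpace Z]
    (e : Y ≃ₜ Z) (h : Contraction Z) : Contraction Y where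
  homotopy := ⟨fun x => e.symm (h.homotopy (x.1, e x.2)), by fun_prop⟩
  point := e.symm h.point
  homotopy_zero y := by simp [h.homotopy_zero]
  homotopy_one y := by simp [h.homotopy_one]

namespace SingChain

variable {κ : Type k} [Field κ]

lemma finiteDimensional_range_map_of_isOpenEmbedding {K Y : Type v} [TopologicalSpace K]
    [CompactSpace K] [TopologicalSpace Y] {F : Type u} [NormedAddCommGroup F] [NormedSpace ℝ F]
    {j : Y → F} (hj : Topology.IsOpenEmbedding j) (g : C(K, Y)) (n : ℕ) :
    FiniteDimensional κ (LinearMap.range (SingHom.map κ n g)) := by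
  have hball : ∀ x : K, ∃ ε > 0, Metric.ball (j (g x)) ε ⊆ Set.range j := fun x =>
    Metric.isOpen_iff.1 hj.isOpen_range _ ⟨_, rfl⟩
  choose ε hε hsub using hball
  let V : K → Set Y := fun x => j ⁻¹' Metric.ball (j (g x)) (ε x)
  have hV : ∀ x, IsOpen (V x) := fun x => Metric.isOpen_ball.preimage hj.continuous
  obtain ⟨t, ht⟩ := isCompact_univ.elim_finite_subcover (fun x => g ⁻¹' V x)
    (fun x => (hV x).preimage g.continuous)
    (fun x _ => Set.mem_iUnion.2 ⟨x, Metric.mem_ball_self (hε x)⟩)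
  -- Convexity of the image in `F` is stable under intersection, and a nonempty such set is
  -- contractible.
  refine finiteDimensional_range_map g (P := fun U => Convex ℝ (j '' U)) ?_ ?_
    (fun i : Fin t.card => V (t.equivFin.symm i)) ?_ (fun i => hV _) ?_ n
  · intro U W hU hW
    rw [Set.image_inter hj.injective]
    exact hU.inter hW
  · intro U hU
    rcases U.eq_empty_or_nonempty with rfl | ⟨p, hp⟩
    · exact hasFiniteHomology_inside_empty
    · exact hasFiniteHomology_inside_of_contraction
        ((Contraction.ofConvex hU ⟨j p, p, hp, rfl⟩).ofHomeomorph
          (hj.toIsEmbedding.homeomorphImage U))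
  · intro i
    simp only [V]
    rw [Set.image_preimage_eq_of_subset (hsub _)]
    exact convex_ball _ _
  · intro x
    obtain ⟨y, hy⟩ := Set.mem_iUnion.1 (ht (Set.mem_univ x))
    obtain ⟨hyt, hxy⟩ := Set.mem_iUnion.1 hy
    refine ⟨t.equivFin ⟨y, hyt⟩, ?_⟩
    rw [Equiv.symm_apply_apply]
    exact hxy

end SingChain

/-! ### Compact ANRs and the geometry of the infinite cyclic cover -/

open scoped lp ENNReal in
lemma IsCompactANR.exists_retraction_lp {X : Type u} [TopologicalSpace X] (hX : IsCompactANR X) :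
    ∃ (i : C(X, lp (fun _ : ℕ => ℝ) ∞)) (U : Set (lp (fun _ : ℕ => ℝ) ∞)) (_ : IsOpen U)
      (hi : ∀ x, i x ∈ U) (ρ : C(U, X)), ∀ x, ρ ⟨i x, hi x⟩ = x := by
  have := hX.compact
  have := hX.metrizable
  let _ : MetricSpace X := TopologicalSpace.metrizableSpaceMetric X
  have hiso := kuratowskiEmbedding.isometry X
  -- The Kuratowski embedding into `ℓ^∞` is lifted to the universe of `X`, where the retraction
  -- property applies.
  have hemb : Topology.IsClosedEmbedding
      (fun x => (ULift.up (kuratowskiEmbedding X x) : ULift.{u} (lp (fun _ : ℕ => ℝ) ∞))) :=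
    Homeomorph.ulift.symm.isClosedEmbedding.comp hiso.isClosedEmbedding
  obtain ⟨U, hU, hi, ρ, hρ⟩ := hX.exists_retraction _ _ hemb
  refine ⟨⟨kuratowskiEmbedding X, hiso.continuous⟩, ULift.up ⁻¹' U, hU.preimage continuous_uliftUp,
    hi, ⟨fun w => ρ ⟨ULift.up w.1, w.2⟩, ?_⟩, hρ⟩
  exact ρ.continuous.comp ((continuous_uliftUp.comp continuous_subtype_val).subtype_mk _)

namespace IsInfiniteCyclicCover

variable {X : Type u} [TopologicalSpace X] {E : Type v} [TopologicalSpace E] [AddAction ℤ E]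
  [ContinuousConstVAdd ℤ E] {f : C(X, Circle)} {π : C(E, X)} {fLift : C(E, ℝ)}

lemma isOpenMap (h : IsInfiniteCyclicCover f π fLift) : IsOpenMap π := by
  obtain ⟨e, he⟩ := h.homeo
  have : (π : E → X) = e ∘ Quotient.mk (AddAction.orbitRel ℤ E) := by
    ext x; exact (he x).symm
  rw [this]
  exact e.isOpenMap.comp isOpenMap_quotient_mk'_add

lemma surjective (h : IsInfiniteCyclicCover f π fLift) : Function.Surjective π := by
  obtain ⟨e, he⟩ := h.homeo
  intro p
  obtain ⟨x, hx⟩ := Quotient.exists_rep (e.symm p)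
  refine ⟨x, ?_⟩
  rw [← he, hx, e.apply_symm_apply]

lemma apply_vadd (h : IsInfiniteCyclicCover f π fLift) (n : ℤ) (x : E) : π (n +ᵥ x) = π x := by
  obtain ⟨e, he⟩ := h.homeo
  rw [← he, ← he]
  congr 1
  exact Quotient.sound ⟨n, rfl⟩

lemma exists_vadd_eq (h : IsInfiniteCyclicCover f π fLift) {x y : E} (hxy : π x = π y) :
    ∃ n : ℤ, n +ᵥ y = x := by
  obtain ⟨e, he⟩ := h.homeo
  rw [← he, ← he] at hxy
  exact Quotient.exact (e.injective hxy)

/-- The cover as the pullback of `ℝ → S¹` along `f`. -/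
def toPullback (h : IsInfiniteCyclicCover f π fLift) :
    E → {q : X × ℝ // f q.1 = Circle.exp q.2} :=
  fun x => ⟨(π x, fLift x), (h.comm x).symm⟩

lemma continuous_toPullback (h : IsInfiniteCyclicCover f π fLift) : Continuous h.toPullback :=
  (π.continuous.prodMk fLift.continuous).subtype_mk _

lemma toPullback_bijective (h : IsInfiniteCyclicCover f π fLift) :
    Function.Bijective h.toPullback := by
  constructor
  · intro x y hxy
    have h1 : π x = π y := congrArg (fun q => q.1.1) hxy
    have h2 : fLift x = fLift y := congrArg (fun q => q.1.2) hxy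
    obtain ⟨n, rfl⟩ := h.exists_vadd_eq h1
    rw [h.equivariant, add_eq_left] at h2
    have hn : n = 0 := by
      simpa [Real.pi_ne_zero] using h2
    rw [hn, zero_vadd]
  · rintro ⟨⟨p, s⟩, hps⟩
    obtain ⟨x, rfl⟩ := h.surjective p
    change f (π x) = Circle.exp s at hps
    rw [← h.comm, eq_comm, Circle.exp_eq_exp] at hps
    obtain ⟨m, hm⟩ := hps
    refine ⟨m +ᵥ x, Subtype.ext (Prod.ext (h.apply_vadd m x) ?_)⟩
    change fLift (m +ᵥ x) = s
    rw [h.equivariant, hm]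
    ring

/-- Two lifts within distance `1` of `fLift x` differ by less than `2π`, so points of the pullback
near the image of `x` have the same sheet as their preimages near `x`. -/
lemma isOpenMap_toPullback (h : IsInfiniteCyclicCover f π fLift) : IsOpenMap h.toPullback := by
  rw [isOpenMap_iff_nhds_le]
  intro x
  rw [Filter.le_map_iff]
  intro U hU
  have hV : U ∩ fLift ⁻¹' Metric.ball (fLift x) 1 ∈ nhds x :=
    Filter.inter_mem hU (fLift.continuous.continuousAt.preimage_mem_nhds
      (Metric.ball_mem_nhds _ one_pos))
  have h1 : {q : {q : X × ℝ // f q.1 = Circle.exp q.2} |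
      q.1.1 ∈ π '' (U ∩ fLift ⁻¹' Metric.ball (fLift x) 1) ∧
        q.1.2 ∈ Metric.ball (fLift x) 1} ∈ nhds (h.toPullback x) := by
    refine Filter.inter_mem ?_ ?_
    · have hc : Continuous fun q : {q : X × ℝ // f q.1 = Circle.exp q.2} => q.1.1 := by fun_prop
      exact (hc.continuousAt (x := h.toPullback x)).preimage_mem_nhds
        (h.isOpenMap.image_mem_nhds hV)
    · have hc : Continuous fun q : {q : X × ℝ // f q.1 = Circle.exp q.2} => q.1.2 := by fun_prop
      exact (hc.continuousAt (x := h.toPullback x)).preimage_mem_nhds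
        (Metric.ball_mem_nhds _ one_pos)
  refine Filter.mem_of_superset h1 ?_
  rintro ⟨⟨p, s⟩, hps⟩ ⟨⟨y, ⟨hyU, hy⟩, rfl⟩, hs⟩
  refine ⟨y, hyU, Subtype.ext (Prod.ext rfl ?_)⟩
  change f (π y) = Circle.exp s at hps
  change s ∈ Metric.ball (fLift x) 1 at hs
  change fLift y ∈ Metric.ball (fLift x) 1 at hy
  change fLift y = s
  rw [← h.comm, Circle.exp_eq_exp] at hps
  obtain ⟨m, hm⟩ := hps
  rw [Metric.mem_ball, Real.dist_eq, abs_lt] at hs hy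
  have hpi := Real.pi_gt_three
  have hm1 : (m : ℝ) < 1 := by nlinarith
  have hm2 : (-1 : ℝ) < m := by nlinarith
  have hm0 : m = 0 := by
    have : m < 1 := by exact_mod_cast hm1
    have : -1 < m := by exact_mod_cast hm2
    omega
  rw [hm, hm0]
  simp

/-- The cover is homeomorphic to the pullback of `ℝ → S¹` along `f`. -/
def homeomorphPullback (h : IsInfiniteCyclicCover f π fLift) :
    E ≃ₜ {q : X × ℝ // f q.1 = Circle.exp q.2} :=
  (Equiv.ofBijective _ h.toPullback_bijective).toHomeomorphOfContinuousOpen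
    h.continuous_toPullback h.isOpenMap_toPullback

lemma isCompact_preimage_Icc (h : IsInfiniteCyclicCover f π fLift) [CompactSpace X] [T2Space X]
    (b a : ℝ) : IsCompact (fLift ⁻¹' Set.Icc b a) := by
  have hcl : IsClosed {q : X × ℝ | f q.1 = Circle.exp q.2} :=
    isClosed_eq (by fun_prop) (by fun_prop)
  have hemb := hcl.isClosedEmbedding_subtypeVal.comp h.homeomorphPullback.isClosedEmbedding
  have hK : IsCompact ((Set.univ : Set X) ×ˢ Set.Icc b a) := isCompact_univ.prod isCompact_Icc
  convert hemb.isCompact_preimage hK using 1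
  ext x
  change _ ↔ (π x, fLift x) ∈ (Set.univ : Set X) ×ˢ Set.Icc b a
  simp

lemma arg_continuousAt {z : Circle} (hz : dist z 1 < 1) :
    ContinuousAt (fun z : Circle => Complex.arg z) z := by
  refine (Complex.continuousAt_arg ?_).comp continuous_subtype_val.continuousAt
  left
  have h1 : ‖(z : ℂ) - 1‖ < 1 := by
    rw [← dist_eq_norm]; exact hz
  have h2 := (abs_lt.1 ((Complex.abs_re_le_norm _).trans_lt h1)).1
  rw [Complex.sub_re, Complex.one_re] at h2
  linarith

open scoped lp ENNReal in
/-- The cover is a retract of an open subset of a normed space. -/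
lemma exists_retraction (h : IsInfiniteCyclicCover f π fLift) (hX : IsCompactANR X) :
    ∃ (N : Type) (_ : TopologicalSpace N) (j : N → lp (fun _ : ℕ => ℝ) ∞ × ℝ)
      (_ : Topology.IsOpenEmbedding j) (g : C(E, N)) (ρ : C(N, E)), ∀ x, ρ (g x) = x := by
  obtain ⟨i, U, hU, hi, ρ, hρ⟩ := hX.exists_retraction_lp
  -- `q` measures the failure of `(ρ u, s)` to lie in the pullback. Where it is close to `1` its
  -- argument is continuous, and adding it to `s` corrects the failure; on the image of the cover `q
  -- = 1`, so nothing moves.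
  let q : U × ℝ → Circle := fun w => f (ρ w.1) / Circle.exp w.2
  have hq : Continuous q := by fun_prop
  let N : Set (U × ℝ) := {w | dist (q w) 1 < 1}
  have hN : IsOpen N := isOpen_lt (by fun_prop) continuous_const
  have harg : Continuous fun w : N => Complex.arg (q w) :=
    continuous_iff_continuousAt.2 fun w =>
      ContinuousAt.comp (f := fun w : N => q w) (arg_continuousAt w.2)
        (hq.comp continuous_subtype_val).continuousAt
  have hgmem : ∀ x, ((⟨i (π x), hi _⟩, fLift x) : U × ℝ) ∈ N := by
    intro x
    simp [N, q, hρ, h.comm]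
  refine ⟨N, inferInstance, _, (hU.isOpenEmbedding_subtypeVal.prodMap
    Topology.IsOpenEmbedding.id).comp hN.isOpenEmbedding_subtypeVal,
    ⟨fun x => ⟨(⟨i (π x), hi _⟩, fLift x), hgmem x⟩, by fun_prop⟩,
    ⟨fun w => h.homeomorphPullback.symm ⟨(ρ w.1.1, w.1.2 + Complex.arg (q w)), ?_⟩, ?_⟩, ?_⟩
  · rw [Circle.exp_add, Circle.exp_arg]
    simp [q]
  · refine h.homeomorphPullback.symm.continuous.comp (Continuous.subtype_mk ?_ _)
    fun_prop
  · intro x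
    simp only [ContinuousMap.coe_mk]
    rw [Homeomorph.symm_apply_eq]
    refine Subtype.ext (Prod.ext (hρ _) ?_)
    change fLift x + Complex.arg (q (⟨i (π x), hi _⟩, fLift x)) = fLift x
    simp [q, hρ, h.comm]

/-- The inclusion of the compact slab factors through `N`, where the image in homology is already
finite-dimensional. -/
lemma finiteDimensional_imageOfSubspace (h : IsInfiniteCyclicCover f π fLift)
    (hX : IsCompactANR X) (κ : Type k) [Field κ] (r : ℕ) (b a : ℝ) :
    FiniteDimensional κ (imageOfSubspace κ r (fLift ⁻¹' Set.Icc b a)) := by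
  have := hX.compact
  have := hX.metrizable
  have : CompactSpace (fLift ⁻¹' Set.Icc b a) :=
    isCompact_iff_compactSpace.1 (h.isCompact_preimage_Icc b a)
  obtain ⟨N, _, j, hj, g, ρ, hρ⟩ := h.exists_retraction hX
  let incl : C(fLift ⁻¹' Set.Icc b a, E) := ⟨Subtype.val, continuous_subtype_val⟩
  let g' : C(fLift ⁻¹' Set.Icc b a, ULift.{v} N) :=
    ⟨fun x => ULift.up (g x), continuous_uliftUp.comp (g.continuous.comp continuous_subtype_val)⟩
  let ρ' : C(ULift.{v} N, E) := ⟨fun w => ρ w.down, ρ.continuous.comp continuous_uliftDown⟩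
  have hincl : incl = ρ'.comp g' := by
    ext x; exact (hρ x).symm
  have hj' : Topology.IsOpenEmbedding (fun w : ULift.{v} N => j w.down) :=
    hj.comp Homeomorph.ulift.isOpenEmbedding
  have := SingChain.finiteDimensional_range_map_of_isOpenEmbedding (κ := κ) hj' g' r
  have hrange : imageOfSubspace κ r (fLift ⁻¹' Set.Icc b a) =
      (LinearMap.range (SingHom.map κ r g')).map (SingHom.map κ r ρ') := by
    rw [← LinearMap.range_comp, ← SingHom.map_comp, ← hincl]
    rfl
  rw [hrange]
  infer_instance

end IsInfiniteCyclicCover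

/-! ### Linear relations among translates in a shifted filtration -/

section LinearAlgebra

variable {κ M : Type*} [Field κ] [AddCommGroup M] [Module κ M]

/-- Solve the relation for its leading term `τ m x`: the other terms have index below `m`, so they
lie one step lower in the filtration. Then translate back by `-m`. -/
lemma mem_sub_one_of_sum_eq_zero {τ : ℤ → M →ₗ[κ] M} (hτ : ∀ n x, τ (-n) (τ n x) = x)
    {J : ℤ → Submodule κ M} (hJ : Monotone J) (hτJ : ∀ n k x, x ∈ J k → τ n x ∈ J (k + n))
    {c : ℤ →₀ κ} (hc : c ≠ 0) {x : M} (h : (c.sum fun n a => a • τ n x) = 0) {k : ℤ}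
    (hx : x ∈ J k) : x ∈ J (k - 1) := by
  have hne : c.support.Nonempty := Finsupp.support_nonempty_iff.2 hc
  set m := c.support.max' hne
  have hm : m ∈ c.support := Finset.max'_mem _ _
  rw [Finsupp.sum, ← Finset.add_sum_erase _ _ hm] at h
  have hmem : c m • τ m x ∈ J (k + m - 1) := by
    rw [eq_neg_of_add_eq_zero_left h]
    refine Submodule.neg_mem _ (Submodule.sum_mem _ fun n hn => Submodule.smul_mem _ _ ?_)
    refine hJ ?_ (hτJ n k x hx)
    have h1 : n ≤ m := Finset.le_max' _ _ (Finset.mem_of_mem_erase hn)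
    have h2 : n ≠ m := Finset.ne_of_mem_erase hn
    omega
  have hmem' : τ m x ∈ J (k + m - 1) := by
    rwa [Submodule.smul_mem_iff _ (Finsupp.mem_support_iff.1 hm)] at hmem
  have := hτJ (-m) _ _ hmem'
  rw [hτ] at this
  convert this using 2
  ring

lemma mem_of_sum_eq_zero {τ : ℤ → M →ₗ[κ] M} (hτ : ∀ n x, τ (-n) (τ n x) = x)
    {J : ℤ → Submodule κ M} (hJ : Monotone J) (hτJ : ∀ n k x, x ∈ J k → τ n x ∈ J (k + n))
    {c : ℤ →₀ κ} (hc : c ≠ 0) {x : M} (h : (c.sum fun n a => a • τ n x) = 0) {k : ℤ}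
    (hx : x ∈ J k) (l : ℤ) : x ∈ J l := by
  have key : ∀ m : ℕ, x ∈ J (k - m) := by
    intro m
    induction m with
    | zero => simpa using hx
    | succ m ih =>
      have := mem_sub_one_of_sum_eq_zero hτ hJ hτJ hc h ih
      convert this using 2
      push_cast
      ring
  exact hJ (by omega) (key (k - l).toNat)

lemma exists_sum_eq_zero {τ : ℤ → M →ₗ[κ] M} {W : Submodule κ M} [FiniteDimensional κ W] {x : M}
    {e : ℕ → ℤ} (he : Function.Injective e) (hx : ∀ n, τ (e n) x ∈ W) :
    ∃ c : ℤ →₀ κ, c ≠ 0 ∧ (c.sum fun n a => a • τ n x) = 0 := by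
  have hdep := Module.Finite.not_linearIndependent_of_infinite (R := κ)
    (fun n : ℕ => (⟨τ (e n) x, hx n⟩ : W))
  rw [linearIndependent_iff] at hdep
  push Not at hdep
  obtain ⟨l, hl, hl0⟩ := hdep
  refine ⟨l.mapDomain e, fun h => hl0 (Finsupp.mapDomain_injective he (by simpa using h)), ?_⟩
  rw [Finsupp.sum_mapDomain_index (by simp) (by intros; rw [add_smul])]
  have := congrArg W.subtype hl
  rw [Finsupp.linearCombination_apply, map_finsuppSum, map_zero] at this
  exact this

end LinearAlgebra

/-! ### Images of sublevels and overlevels in homology -/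

namespace SingChain

variable {κ : Type k} [Field κ] {r : ℕ} {E : Type v} [TopologicalSpace E]

/-- The inclusion is injective on chains, so a cycle of `E` supported in `A` is already a cycle of
`A`. -/
lemma mem_imageOfSubspace_iff {A : Set E} {x : SingHom κ r E} :
    x ∈ imageOfSubspace κ r A ↔
      ∃ z : cycles κ r E, z.1 ∈ inside κ r A ∧ homologyClass κ r E z = x := by
  constructor
  · rintro ⟨y, rfl⟩
    obtain ⟨z, rfl⟩ := homologyClass_surjective y
    rw [map_homologyClass]
    refine ⟨_, ?_, rfl⟩
    rw [inside_eq_range_map]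
    exact ⟨z.1, rfl⟩
  · rintro ⟨⟨z, hzc⟩, hz, rfl⟩
    change z ∈ inside κ r A at hz
    rw [inside_eq_range_map] at hz
    obtain ⟨z, rfl⟩ := hz
    refine ⟨homologyClass κ r A ⟨z, mem_cycles_of_map Subtype.val_injective hzc⟩, ?_⟩
    rw [map_homologyClass]

end SingChain

section Levels

variable {κ : Type k} [Field κ] {r : ℕ} {E : Type v} [TopologicalSpace E]

lemma imageOfSubspace_mono {A B : Set E} (h : A ⊆ B) :
    imageOfSubspace κ r A ≤ imageOfSubspace κ r B := by
  intro x hx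
  rw [SingChain.mem_imageOfSubspace_iff] at hx ⊢
  obtain ⟨z, hz, rfl⟩ := hx
  exact ⟨z, SingChain.inside_mono h hz, rfl⟩

lemma subImage_mono (g : C(E, ℝ)) : Monotone (subImage κ r g) := fun _ _ h =>
  imageOfSubspace_mono (Set.preimage_mono (Set.Iic_subset_Iic.2 h))

lemma overImage_antitone (g : C(E, ℝ)) : Antitone (overImage κ r g) := fun _ _ h =>
  imageOfSubspace_mono (Set.preimage_mono (Set.Ici_subset_Ici.2 h))

lemma map_mem_imageOfSubspace (g : C(E, E)) {A B : Set E} (h : Set.MapsTo g A B)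
    {x : SingHom κ r E} (hx : x ∈ imageOfSubspace κ r A) :
    SingHom.map κ r g x ∈ imageOfSubspace κ r B := by
  rw [SingChain.mem_imageOfSubspace_iff] at hx ⊢
  obtain ⟨z, hz, rfl⟩ := hx
  rw [SingChain.map_homologyClass]
  refine ⟨_, ?_, rfl⟩
  exact SingChain.lmapDomain_mem_supported _ (by intro σ hσ t; exact h (hσ t)) hz

/-- A singular chain has compact support, on which `g` is bounded. -/
lemma exists_mem_imageOfSubspace_Icc (g : C(E, ℝ)) (x : SingHom κ r E) :
    ∃ C : ℝ, x ∈ imageOfSubspace κ r (g ⁻¹' Set.Icc (-C) C) := by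
  obtain ⟨z, rfl⟩ := SingChain.homologyClass_surjective x
  have hb : ∀ σ : C(stdSimplex ℝ (Fin (r + 1)), E), ∃ C : ℝ, ∀ t, |g (σ t)| ≤ C := by
    intro σ
    obtain ⟨C, hC⟩ := (isCompact_univ (X := stdSimplex ℝ (Fin (r + 1)))).exists_bound_of_continuousOn
      (g.comp σ).continuous.continuousOn
    exact ⟨C, fun t => hC t (Set.mem_univ _)⟩
  choose C hC using hb
  obtain ⟨B, hB⟩ := (z.1.support.image C).bddAbove
  refine ⟨B, SingChain.mem_imageOfSubspace_iff.2 ⟨z, ?_, rfl⟩⟩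
  intro σ hσ t
  exact abs_le.1 ((hC σ t).trans (hB (by simpa using ⟨σ, by simpa using hσ, rfl⟩)))

/-- The strict inequality `c < a` makes the interiors of the sublevel and the overlevel cover `E`,
as Mayer-Vietoris requires. -/
lemma levelInter_le_imageOfSubspace (g : C(E, ℝ)) {a b c : ℝ} (hcb : c ≤ b) (hca : c < a) :
    levelInter κ r g a b ≤ imageOfSubspace κ r (g ⁻¹' Set.Icc c a) := by
  rintro x ⟨hxa, hxb⟩
  replace hxb := overImage_antitone g hcb hxb
  obtain ⟨z, hz, rfl⟩ := SingChain.mem_imageOfSubspace_iff.1 hxa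
  obtain ⟨z', hz', hzz'⟩ := SingChain.mem_imageOfSubspace_iff.1 hxb
  obtain ⟨w, hw⟩ := SingChain.exists_boundary_of_homologyClass_eq hzz'.symm
  have hcov : interior (g ⁻¹' Set.Iic a) ∪ interior (g ⁻¹' Set.Ici c) = Set.univ := by
    rw [Set.eq_univ_iff_forall]
    intro x
    rcases lt_or_ge (g x) a with h | h
    · exact Or.inl (interior_maximal (Set.preimage_mono Set.Iio_subset_Iic_self)
        (isOpen_Iio.preimage g.continuous) h)
    · exact Or.inr (interior_maximal (Set.preimage_mono Set.Ioi_subset_Ici_self)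
        (isOpen_Ioi.preimage g.continuous) (hca.trans_le h))
  obtain ⟨y, hy, w', hw'⟩ := SingChain.exists_mem_inside_inter hcov hz hz' z.2 w hw
  have hyc : y ∈ SingChain.cycles κ r E := by
    have : y = z.1 - SingChain.boundary r E w' := by rw [hw', sub_sub_cancel]
    rw [this]
    exact Submodule.sub_mem _ z.2 (SingChain.boundary_mem_cycles w')
  refine SingChain.mem_imageOfSubspace_iff.2 ⟨⟨y, hyc⟩, SingChain.inside_mono ?_ hy,
    (SingChain.homologyClass_eq_of_boundary hw').symm⟩
  rintro t ⟨ht, ht'⟩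
  exact ⟨ht', ht⟩

end Levels

/-! ### Deck transformations and torsion -/

section Deck

variable {κ : Type k} [Field κ] {r : ℕ} {E : Type v} [TopologicalSpace E] [AddAction ℤ E]
  [ContinuousConstVAdd ℤ E]

lemma laurent_smul_eq_sum (p : κ[T;T⁻¹]) (x : SingHom κ r E) :
    p • x = p.coeff.sum fun n a => a • SingHom.map κ r (deckMap E n) x := by
  rw [laurent_smul_def, AddMonoidAlgebra.lift_apply, Finsupp.sum, LinearMap.sum_apply]
  rfl

/-- Laurent polynomials over a field form a domain, so the non-zero-divisors are the nonzero
coefficient families. -/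
lemma mem_torsionSub_iff {x : SingHom κ r E} :
    x ∈ torsionSub κ r E ↔ ∃ c : ℤ →₀ κ, c ≠ 0 ∧
      (c.sum fun n a => a • SingHom.map κ r (deckMap E n) x) = 0 := by
  rw [torsionSub, Submodule.restrictScalars_mem, Submodule.mem_torsion_iff]
  constructor
  · rintro ⟨⟨p, hp⟩, hpx⟩
    refine ⟨p.coeff, fun h => nonZeroDivisors.ne_zero hp (LaurentPolynomial.ext fun a => ?_), ?_⟩
    · rw [h]; rfl
    · rw [← laurent_smul_eq_sum]; exact hpx
  · rintro ⟨c, hc, hcx⟩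
    refine ⟨⟨.ofCoeff c, mem_nonZeroDivisors_of_ne_zero fun h => hc ?_⟩, ?_⟩
    · exact congrArg AddMonoidAlgebra.coeff h
    · exact (laurent_smul_eq_sum _ x).trans hcx

lemma map_deckMap_neg (n : ℤ) (x : SingHom κ r E) :
    SingHom.map κ r (deckMap E (-n)) (SingHom.map κ r (deckMap E n) x) = x := by
  rw [← LinearMap.comp_apply, ← SingHom.map_comp]
  have : (deckMap E (-n)).comp (deckMap E n) = ContinuousMap.id E := by
    ext y; simp [deckMap]
  rw [this, SingHom.map_id, LinearMap.id_apply]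

variable {X : Type u} [TopologicalSpace X] {f : C(X, Circle)} {π : C(E, X)} {fLift : C(E, ℝ)}

namespace IsInfiniteCyclicCover

lemma map_deckMap_mem_subImage (h : IsInfiniteCyclicCover f π fLift) (n : ℤ) {a : ℝ}
    {x : SingHom κ r E} (hx : x ∈ subImage κ r fLift a) :
    SingHom.map κ r (deckMap E n) x ∈ subImage κ r fLift (a + 2 * Real.pi * n) := by
  refine map_mem_imageOfSubspace _ (fun y hy => ?_) hx
  change fLift (n +ᵥ y) ≤ _
  rw [h.equivariant]
  exact add_le_add_left hy _

lemma map_deckMap_mem_overImage (h : IsInfiniteCyclicCover f π fLift) (n : ℤ) {b : ℝ}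
    {x : SingHom κ r E} (hx : x ∈ overImage κ r fLift b) :
    SingHom.map κ r (deckMap E n) x ∈ overImage κ r fLift (b + 2 * Real.pi * n) := by
  refine map_mem_imageOfSubspace _ (fun y hy => ?_) hx
  change _ ≤ fLift (n +ᵥ y)
  rw [h.equivariant]
  exact add_le_add_left hy _

lemma torsionSub_le_subImageInf (h : IsInfiniteCyclicCover f π fLift) :
    torsionSub κ r E ≤ subImageInf κ r fLift := by
  intro x hx
  obtain ⟨c, hc, hcx⟩ := mem_torsionSub_iff.1 hx
  obtain ⟨C, hC⟩ := exists_mem_imageOfSubspace_Icc fLift x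
  replace hC : x ∈ subImage κ r fLift C :=
    imageOfSubspace_mono (Set.preimage_mono Set.Icc_subset_Iic_self) hC
  rw [subImageInf, Submodule.mem_iInf]
  intro a
  have hpi := Real.two_pi_pos
  -- Sampling the levels at multiples of `2π` gives a filtration indexed by `ℤ` in which the `n`-th
  -- deck map shifts by `n`.
  refine subImage_mono fLift ?_ (mem_of_sum_eq_zero (k := ⌈C / (2 * Real.pi)⌉)
    (J := fun l : ℤ => subImage κ r fLift (2 * Real.pi * l)) map_deckMap_neg ?_ ?_ hc hcx ?_
    ⌊a / (2 * Real.pi)⌋)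
  · rw [← le_div_iff₀' hpi]
    exact Int.floor_le _
  · intro l m hlm
    refine subImage_mono fLift (mul_le_mul_of_nonneg_left ?_ hpi.le)
    exact_mod_cast hlm
  · intro n l y hy
    have := h.map_deckMap_mem_subImage n hy
    rwa [← mul_add, ← Int.cast_add] at this
  · refine subImage_mono fLift ?_ hC
    rw [← div_le_iff₀' hpi]
    exact Int.le_ceil _

lemma torsionSub_le_overImageInf (h : IsInfiniteCyclicCover f π fLift) :
    torsionSub κ r E ≤ overImageInf κ r fLift := by
  intro x hx
  obtain ⟨c, hc, hcx⟩ := mem_torsionSub_iff.1 hx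
  obtain ⟨C, hC⟩ := exists_mem_imageOfSubspace_Icc fLift x
  replace hC : x ∈ overImage κ r fLift (-C) :=
    imageOfSubspace_mono (Set.preimage_mono Set.Icc_subset_Ici_self) hC
  rw [overImageInf, Submodule.mem_iInf]
  intro b
  have hpi := Real.two_pi_pos
  -- Overlevel images decrease, so the sign of the levels and of the action is reversed to obtain an
  -- increasing filtration.
  have hc' : c.mapDomain Neg.neg ≠ 0 := fun h0 =>
    hc (Finsupp.mapDomain_injective neg_injective (by simpa using h0))
  have hcx' : ((c.mapDomain Neg.neg).sum fun n a => a • SingHom.map κ r (deckMap E (-n)) x) = 0 := by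
    rw [Finsupp.sum_mapDomain_index (by simp) (by intros; rw [add_smul])]
    simpa using hcx
  refine overImage_antitone fLift ?_ (mem_of_sum_eq_zero (k := ⌈C / (2 * Real.pi)⌉)
    (J := fun l : ℤ => overImage κ r fLift (-(2 * Real.pi * l)))
    (τ := fun n => SingHom.map κ r (deckMap E (-n))) (fun n => map_deckMap_neg (-n)) ?_ ?_
    hc' hcx' ?_ ⌊-b / (2 * Real.pi)⌋)
  · rw [le_neg, ← le_div_iff₀' hpi]
    exact Int.floor_le _
  · intro l m hlm
    refine overImage_antitone fLift (neg_le_neg (mul_le_mul_of_nonneg_left ?_ hpi.le))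
    exact_mod_cast hlm
  · intro n l y hy
    have := h.map_deckMap_mem_overImage (-n) hy
    convert this using 2
    push_cast
    ring
  · refine overImage_antitone fLift (neg_le_neg ?_) hC
    rw [← div_le_iff₀' hpi]
    exact Int.le_ceil _

lemma finiteDimensional_levelInter (h : IsInfiniteCyclicCover f π fLift) (hX : IsCompactANR X)
    (κ : Type k) [Field κ] (r : ℕ) (a b : ℝ) :
    FiniteDimensional κ (levelInter κ r fLift a b) := by
  have := h.finiteDimensional_imageOfSubspace hX κ r (min b (a - 1)) a
  exact Submodule.finiteDimensional_of_le (levelInter_le_imageOfSubspace fLift (min_le_left _ _)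
    ((min_le_right _ _).trans_lt (sub_one_lt a)))

lemma subImageInf_le_torsionSub (h : IsInfiniteCyclicCover f π fLift) (hX : IsCompactANR X) :
    subImageInf κ r fLift ≤ torsionSub κ r E := by
  intro x hx
  rw [subImageInf, Submodule.mem_iInf] at hx
  obtain ⟨C, hC⟩ := exists_mem_imageOfSubspace_Icc fLift x
  replace hC : x ∈ overImage κ r fLift (-C) :=
    imageOfSubspace_mono (Set.preimage_mono Set.Icc_subset_Ici_self) hC
  have := h.finiteDimensional_levelInter hX κ r 0 (-C)
  refine mem_torsionSub_iff.2 (exists_sum_eq_zero (τ := fun n => SingHom.map κ r (deckMap E n))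
    (W := levelInter κ r fLift 0 (-C)) (e := fun n => (n : ℤ)) Nat.cast_injective fun n => ⟨?_, ?_⟩)
  · have := h.map_deckMap_mem_subImage n (hx (-(2 * Real.pi * (n : ℤ))))
    rwa [neg_add_cancel] at this
  · refine overImage_antitone fLift ?_ (h.map_deckMap_mem_overImage n hC)
    have : (0 : ℝ) ≤ 2 * Real.pi * ((n : ℤ) : ℝ) := by positivity
    linarith

lemma overImageInf_le_torsionSub (h : IsInfiniteCyclicCover f π fLift) (hX : IsCompactANR X) :
    overImageInf κ r fLift ≤ torsionSub κ r E := by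
  intro x hx
  rw [overImageInf, Submodule.mem_iInf] at hx
  obtain ⟨C, hC⟩ := exists_mem_imageOfSubspace_Icc fLift x
  replace hC : x ∈ subImage κ r fLift C :=
    imageOfSubspace_mono (Set.preimage_mono Set.Icc_subset_Iic_self) hC
  have := h.finiteDimensional_levelInter hX κ r C 0
  refine mem_torsionSub_iff.2 (exists_sum_eq_zero (τ := fun n => SingHom.map κ r (deckMap E n))
    (W := levelInter κ r fLift C 0) (e := fun n => -(n : ℤ))
    (fun m n hmn => by simpa using hmn) fun n => ⟨?_, ?_⟩)
  · refine subImage_mono fLift ?_ (h.map_deckMap_mem_subImage (-n) hC)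
    have : (0 : ℝ) ≤ 2 * Real.pi * (n : ℝ) := by positivity
    push_cast
    linarith
  · have := h.map_deckMap_mem_overImage (-n) (hx (-(2 * Real.pi * ((-n : ℤ) : ℝ))))
    rwa [neg_add_cancel] at this

end IsInfiniteCyclicCover

end Deck

end

theorem proposition3p2 {X : Type u} [TopologicalSpace X] (hX : IsCompactANR X)
    (f : C(X, Circle)) {E : Type v} [TopologicalSpace E] [AddAction ℤ E]
    [ContinuousConstVAdd ℤ E] (π : C(E, X)) (fLift : C(E, ℝ))
    (hcover : IsInfiniteCyclicCover f π fLift) (κ : Type k) [Field κ] (r : ℕ) :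
    (∀ a b : ℝ, FiniteDimensional κ (levelInter κ r fLift a b)) ∧
      subImageInf κ r fLift = overImageInf κ r fLift ∧
      overImageInf κ r fLift = torsionSub κ r E := by
  have h1 : subImageInf κ r fLift = torsionSub κ r E :=
    le_antisymm (hcover.subImageInf_le_torsionSub hX) hcover.torsionSub_le_subImageInf
  have h2 : overImageInf κ r fLift = torsionSub κ r E :=
    le_antisymm (hcover.overImageInf_le_torsionSub hX) hcover.torsionSub_le_overImageInf
  exact ⟨hcover.finiteDimensional_levelInter hX κ r, h1.trans h2.symm, h2⟩
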